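/- Let $L,\tilde a>0$ be such that $L/\tilde a$ is a positive integer, and fix $r,s\in\{+,-\}$. Write vectors of $\mathbb R^2$ as $\mathbf k=(k_+,k_-)$ and let $\mathbf e_\pm$ be the coordinate unit vectors. For $t=\pm$ put $$\Lambda_t^*=\{\mathbf k: k_\pm\in\tfrac{2\pi}{L}(\mathbb Z+\tfrac12),\ -\tfrac{\pi}{\tilde a}\le k_{-t}<\tfrac{\pi}{\tilde a}\},\qquad \tilde\Lambda_t^*=\{\mathbf p: p_\pm\in\tfrac{2\pi}{L}\mathbb Z,\ -\tfrac{\pi}{\tilde a}\le p_{-t}<\tfrac{\pi}{\tilde a}\}.$$ Let $\mathcal F$ be the fermion Fock space of the operators $\hat\psi_{r',s',\alpha}(\mathbf k)$ ($r',s',\alpha=\pm$, $\mathbf k\in\Lambda_{s'}^*$), which satisfy $\{\hat\psi_{r',s',\alpha}(\mathbf k),\hat\psi^\dagger_{r'',s'',\alpha'}(\mathbf k')\}=(L/2\pi)^2\delta_{r',r''}\delta_{s',s''}\delta_{\alpha,\alpha'}\delta_{\mathbf k,\mathbf k'}$ and $\{\hat\psi,\hat\psi\}=0$, over the normalized Dirac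 vacuum $\Omega$, for which $\hat\psi_{r',s',\alpha}(\mathbf k)\Omega=0$ if $r'k_{s'}>0$ and $\hat\psi^\dagger_{r',s',\alpha}(\mathbf k)\Omega=0$ if $r'k_{s'}<0$. Put $:\!\mathcal O\!:\,=\mathcal O-\langle\Omega,\mathcal O\Omega\rangle$ for fermion bilinears $\mathcal O$. For $\mathbf p$ with $p_\pm\in\tfrac{2\pi}{L}\mathbb Z$ let $$\hat J^\mu_{r,s}(\mathbf p)=\sum_{\alpha,\beta=\pm}\ \sum_{\mathbf k_1,\mathbf k_2\in\Lambda_s^*}\ \sum_{n\in\mathbb Z}\Bigl(\tfrac{2\pi}{L}\Bigr)^2:\!\hat\psi^\dagger_{r,s,\alpha}(\mathbf k_1)\sigma^\mu_{\alpha,\beta}\hat\psi_{r,s,\beta}(\mathbf k_2)\!:\ \delta_{\mathbf k_1+\mathbf p,\ \mathbf k_2+2\pi n\mathbf e_{-s}/\tilde a}\qquad(\mu=0,1,2,3),$$ where $\sigma^0$ is the unit matrix and $\sigma^1,\sigma^2,\sigma^3$ are the Pauli matrices, and set $\hat J_{r,s}=\hat J^0_{r,s}$, $\hat J_{r,s,\pm}=\frac12(\hat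 J^0_{r,s}\pm\hat J^3_{r,s})$, $\hat S^i_{r,s}=\frac12\hat J^i_{r,s}$ for $i=1,2,3$. Write $A^\dagger A$ for $A(-\mathbf p)A(\mathbf p)$ and $\hat{\mathbf S}^\dagger\cdot\hat{\mathbf S}=\sum_{i=1}^3(\hat S^i)^\dagger\hat S^i$. The boson normal ordering $\stackrel{\times}{\times}A(\mathbf p)A(\mathbf p')\stackrel{\times}{\times}$ of operators of flavor $(r,s)$ is $A(\mathbf p)A(\mathbf p')$ if $rp_s<0$ and $A(\mathbf p')A(\mathbf p)$ if $rp_s\ge0$. Consider the three expressions $$H_1=\sum_{\alpha=\pm}\sum_{\mathbf k\in\Lambda_s^*}\Bigl(\tfrac{2\pi}{L}\Bigr)^2rk_s:\!\hat\psi^\dagger_{r,s,\alpha}(\mathbf k)\hat\psi_{r,s,\alpha}(\mathbf k)\!:,\qquad H_2=\tilde a\pi\sum_{\alpha=\pm}\sum_{\mathbf p\in\tilde\Lambda_s^*}\frac1{L^2}\stackrel{\times}{\times}\hat J^\dagger_{r,s,\alpha}\hat J_{r,s,\alpha}\stackrel{\times}{\times},$$ $$H_3=\tilde a\pi\sum_{\mathbf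 p\in\tilde\Lambda_s^*}\frac1{L^2}\stackrel{\times}{\times}\Bigl(\tfrac12\hat J^\dagger_{r,s}\hat J_{r,s}+\tfrac23\hat{\mathbf S}^\dagger_{r,s}\cdot\hat{\mathbf S}_{r,s}\Bigr)\stackrel{\times}{\times},$$ each as an operator on its natural domain in $\mathcal F$ (all vectors on which all products are defined and all series converge unconditionally in norm). Then all finite linear combinations of the occupation number basis vectors of $\mathcal F$ (particles and holes relative to $\Omega$) lie in the three domains, and on them $H_1=H_2$ (Kronig identity) and $H_2=H_3$ (two-dimensional Sugawara construction). All three expressions define self-adjoint operators, and these are the same operator: $H_1$ is self-adjoint, the closures $\overline{H_2}$ and $\overline{H_3}$ are self-adjoint, and $H_1=\overline{H_2}=\overline{H_3}$. -/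

import Mathlib

open scoped InnerProductSpace

/-! ### Unbounded operators on their natural domains -/

namespace UnboundedOp

variable {F : Type*} [NormedAddCommGroup F] [InnerProductSpace ℂ F]

/-- An everywhere defined bounded operator, seen as an unbounded operator. -/
def ofBounded (A : F →L[ℂ] F) : F →ₗ.[ℂ] F := (A : F →ₗ[ℂ] F).toPMap ⊤

/-- The operator product `S T`, with domain all `η` such that `η ∈ dom T` and `T η ∈ dom S`. -/
def mul (S T : F →ₗ.[ℂ] F) : F →ₗ.[ℂ] F where
  domain :=
    { carrier := {η | ∃ h : η ∈ T.domain, T ⟨η, h⟩ ∈ S.domain}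
      zero_mem' := ⟨T.domain.zero_mem, by
        have h0 : T ⟨0, T.domain.zero_mem⟩ = 0 := T.map_zero
        rw [h0]; exact S.domain.zero_mem⟩
      add_mem' := by
        rintro x y ⟨hx, hx'⟩ ⟨hy, hy'⟩
        refine ⟨T.domain.add_mem hx hy, ?_⟩
        have h0 : T ⟨x + y, T.domain.add_mem hx hy⟩ = T ⟨x, hx⟩ + T ⟨y, hy⟩ :=
          T.map_add ⟨x, hx⟩ ⟨y, hy⟩
        rw [h0]; exact S.domain.add_mem hx' hy'
      smul_mem' := by
        rintro c x ⟨hx, hx'⟩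
        refine ⟨T.domain.smul_mem c hx, ?_⟩
        have h0 : T ⟨c • x, T.domain.smul_mem c hx⟩ = c • T ⟨x, hx⟩ :=
          T.map_smul c ⟨x, hx⟩
        rw [h0]; exact S.domain.smul_mem c hx' }
  toFun :=
    { toFun := fun η => S ⟨T ⟨η.1, η.2.choose⟩, η.2.choose_spec⟩
      map_add' := by
        rintro ⟨x, hx, hx'⟩ ⟨y, hy, hy'⟩
        rw [← S.map_add]
        congr 1
        exact Subtype.ext (T.map_add ⟨x, hx⟩ ⟨y, hy⟩)
      map_smul' := by
        rintro c ⟨x, hx, hx'⟩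
        rw [RingHom.id_apply, ← S.map_smul]
        congr 1
        exact Subtype.ext (T.map_smul c ⟨x, hx⟩) }

/-- The sum `∑ᵢ Tᵢ` of a (possibly infinite) family of operators. Its domain consists of all `η`
in the domain of every `Tᵢ` for which the family `Tᵢ η` is (unconditionally) summable in norm. -/
noncomputable def sum {ι : Type*} (T : ι → (F →ₗ.[ℂ] F)) : F →ₗ.[ℂ] F where
  domain :=
    { carrier := {η | ∃ h : ∀ i, η ∈ (T i).domain, Summable fun i => T i ⟨η, h i⟩}
      zero_mem' := ⟨fun i => (T i).domain.zero_mem, by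
        have h0 : (fun i => T i ⟨0, (T i).domain.zero_mem⟩) = fun _ => 0 :=
          funext fun i => (T i).map_zero
        rw [h0]; exact summable_zero⟩
      add_mem' := by
        rintro x y ⟨hx, hx'⟩ ⟨hy, hy'⟩
        refine ⟨fun i => (T i).domain.add_mem (hx i) (hy i), ?_⟩
        have h0 : (fun i => T i ⟨x + y, (T i).domain.add_mem (hx i) (hy i)⟩)
            = fun i => T i ⟨x, hx i⟩ + T i ⟨y, hy i⟩ :=
          funext fun i => (T i).map_add ⟨x, hx i⟩ ⟨y, hy i⟩
        rw [h0]; exact hx'.add hy'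
      smul_mem' := by
        rintro c x ⟨hx, hx'⟩
        refine ⟨fun i => (T i).domain.smul_mem c (hx i), ?_⟩
        have h0 : (fun i => T i ⟨c • x, (T i).domain.smul_mem c (hx i)⟩)
            = fun i => c • T i ⟨x, hx i⟩ :=
          funext fun i => (T i).map_smul c ⟨x, hx i⟩
        rw [h0]; exact hx'.const_smul c }
  toFun :=
    { toFun := fun η => ∑' i, T i ⟨η.1, η.2.choose i⟩
      map_add' := by
        rintro ⟨x, hx, hx'⟩ ⟨y, hy, hy'⟩
        rw [← hx'.tsum_add hy']
        exact tsum_congr fun i => (T i).map_add ⟨x, hx i⟩ ⟨y, hy i⟩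
      map_smul' := by
        rintro c ⟨x, hx, hx'⟩
        rw [RingHom.id_apply, ← hx'.tsum_const_smul c]
        exact tsum_congr fun i => (T i).map_smul c ⟨x, hx i⟩ }

end UnboundedOp

/-! ### Fermion Fock space over a set of modes, in the occupation number representation -/

/-- The Hilbert space `ℓ²` over all finite sets of occupied modes. -/
abbrev FermionFock (ι : Type*) : Type _ := lp (fun _ : Finset ι => ℂ) 2

namespace FermionFock

variable {ι : Type*}

/-- The number basis vector in which exactly the modes in `S` are occupied. -/
noncomputable def basisVec (S : Finset ι) : FermionFock ι :=
  open Classical in lp.single 2 S (1 : ℂ)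

/-- The vacuum: no mode is occupied. -/
noncomputable def vacuum : FermionFock ι := basisVec ∅

/-- The finite linear combinations of number basis vectors. -/
noncomputable def finiteVectors (ι : Type*) : Submodule ℂ (FermionFock ι) :=
  Submodule.span ℂ (Set.range basisVec)

variable [LinearOrder ι]

/-- `(-1)` to the number of modes of `S` preceding `q` (Jordan–Wigner sign). -/
def jwSign (q : ι) (S : Finset ι) : ℂ := (-1) ^ (S.filter (· < q)).card

/-- The coefficients of `a(q) f`, where `a(q)` removes the mode `q`. -/
def annCoeff (q : ι) (f : Finset ι → ℂ) (S : Finset ι) : ℂ :=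
  if q ∈ S then 0 else jwSign q S * f (insert q S)

theorem norm_annCoeff_sq_le (q : ι) (f : FermionFock ι) (s : Finset (Finset ι)) :
    ∑ S ∈ s, ‖annCoeff q f S‖ ^ 2 ≤ ‖f‖ ^ 2 := by
  have h1 : ∑ S ∈ s, ‖annCoeff q f S‖ ^ 2
      = ∑ S ∈ s.filter (fun S => q ∉ S), ‖f (insert q S)‖ ^ 2 := by
    rw [Finset.sum_filter]
    refine Finset.sum_congr rfl fun S _ => ?_
    by_cases h : q ∈ S <;> simp [annCoeff, jwSign, h]
  have h2 : ∑ S ∈ s.filter (fun S => q ∉ S), ‖f (insert q S)‖ ^ 2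
      = ∑ S ∈ (s.filter (fun S => q ∉ S)).image (insert q), ‖f S‖ ^ 2 := by
    rw [Finset.sum_image]
    intro S hS T hT h
    simp only [Finset.coe_filter, Set.mem_ofPred_eq] at hS hT
    rw [← Finset.erase_insert hS.2, ← Finset.erase_insert hT.2]
    exact congrArg (fun U => Finset.erase U q) h
  rw [h1, h2]
  have := lp.sum_rpow_le_norm_rpow (p := 2) (by norm_num) f
    ((s.filter (fun S => q ∉ S)).image (insert q))
  simpa using this

/-- The bounded annihilation operator `a(q)` of the mode `q`. -/
noncomputable def ann (q : ι) : FermionFock ι →L[ℂ] FermionFock ι :=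
  LinearMap.mkContinuous
    { toFun := fun f => ⟨annCoeff q f, memℓp_gen' (C := ‖f‖ ^ 2) fun s => by
        simpa using norm_annCoeff_sq_le q f s⟩
      map_add' := fun f g => by
        ext S
        change annCoeff q (f + g) S = annCoeff q f S + annCoeff q g S
        by_cases h : q ∈ S <;> simp [annCoeff, h, mul_add]
      map_smul' := fun c f => by
        ext S
        change annCoeff q (c • f) S = c * annCoeff q f S
        by_cases h : q ∈ S <;> simp [annCoeff, h, mul_left_comm] } 1
    fun f => by
      rw [one_mul]
      refine lp.norm_le_of_forall_sum_le (by norm_num) (norm_nonneg f) fun s => ?_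
      simpa using norm_annCoeff_sq_le q f s

end FermionFock

/-! ### Nodal fermions -/

namespace Nodal

/-- The vectors of `ℝ²` are written in the coordinates `(k₊, k₋)`, indexed by the signs `±1`. -/
abbrev Momentum : Type := ℤˣ → ℝ

/-- The sign `±1` as a real number. -/
def sgn (t : ℤˣ) : ℝ := ((t : ℤ) : ℝ)

/-- Fermion momenta: `k± ∈ (2π/L)(ℤ + 1/2)`, with `k₋ₛ` in the interval `[-π/ã, π/ã)`. -/
def fermiMomenta (L a : ℝ) (s : ℤˣ) : Set Momentum :=
  {k | (∀ t, ∃ m : ℤ, k t = 2 * Real.pi / L * (m + 1 / 2)) ∧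
    -(Real.pi / a) ≤ k (-s) ∧ k (-s) < Real.pi / a}

/-- Boson momenta: `p± ∈ (2π/L)ℤ`, with `p₋ₛ` in the interval `[-π/ã, π/ã)`. -/
def bosonMomenta (L a : ℝ) (s : ℤˣ) : Set Momentum :=
  {p | (∀ t, ∃ m : ℤ, p t = 2 * Real.pi / L * m) ∧
    -(Real.pi / a) ≤ p (-s) ∧ p (-s) < Real.pi / a}

/-- The one-particle modes: flavor `(r, s)`, spin `α` and momentum `k`. -/
structure Mode (L a : ℝ) where
  r : ℤˣ
  s : ℤˣ
  α : ℤˣ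
  k : fermiMomenta L a s

/-- An arbitrary linear order of the modes, needed only to fix the signs in the occupation number
representation. -/
noncomputable instance instLinearOrderMode (L a : ℝ) : LinearOrder (Mode L a) :=
  open Classical in linearOrderOfSTO WellOrderingRel

/-- The nodal fermion Fock space. Since the reference state is the Dirac sea, an occupied mode is
a particle if `r kₛ > 0` and a hole if `r kₛ < 0`. -/
abbrev Fock (L a : ℝ) : Type := FermionFock (Mode L a)

/-- The Dirac vacuum. -/
noncomputable def Ω (L a : ℝ) : Fock L a := FermionFock.vacuum

variable {L a : ℝ}

/-- The fermion operator `ψ̂_{r,s,α}(k)`, normalised by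
`{ψ̂(q), ψ̂†(q')} = (L/2π)² δ_{q,q'}`: it annihilates a particle if `r kₛ > 0` and creates a hole
if `r kₛ < 0`. -/
noncomputable def psi (r s α : ℤˣ) (k : fermiMomenta L a s) : Fock L a →L[ℂ] Fock L a :=
  ((L / (2 * Real.pi) : ℝ) : ℂ) •
    if 0 < sgn r * k.1 s then FermionFock.ann ⟨r, s, α, k⟩
    else ContinuousLinearMap.adjoint (FermionFock.ann ⟨r, s, α, k⟩)

/-- The Hilbert space adjoint `ψ̂†_{r,s,α}(k)`. -/
noncomputable def psiDag (r s α : ℤˣ) (k : fermiMomenta L a s) : Fock L a →L[ℂ] Fock L a :=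
  ContinuousLinearMap.adjoint (psi r s α k)

/-- Fermion normal ordering of a bilinear: `:O: = O - ⟨Ω, O Ω⟩`. -/
noncomputable def fermionOrder (O : Fock L a →L[ℂ] Fock L a) : Fock L a →L[ℂ] Fock L a :=
  O - ⟪Ω L a, O (Ω L a)⟫_ℂ • ContinuousLinearMap.id ℂ (Fock L a)

/-- The unit matrix `σ⁰` and the Pauli matrices `σ¹, σ², σ³`, with spin indices `±1`. -/
noncomputable def pauli : Fin 4 → Matrix ℤˣ ℤˣ ℂ
  | 0 => 1
  | 1 => Matrix.of fun α β => if α = β then 0 else 1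
  | 2 => Matrix.of fun α β => if α = β then 0 else -(Complex.I * (sgn α : ℂ))
  | 3 => Matrix.diagonal fun α => (sgn α : ℂ)

/-- The nodal bilinears
`Ĵ^μ_{r,s}(p) = ∑_{α,β} ∑_{k₁,k₂} ∑ₙ (2π/L)² :ψ̂†_{r,s,α}(k₁) σ^μ_{α,β} ψ̂_{r,s,β}(k₂):`
restricted to `k₁ + p = k₂ + (2πn/ã) e₋ₛ`. -/
noncomputable def J (L a : ℝ) (r s : ℤˣ) (μ : Fin 4) (p : Momentum) :
    Fock L a →ₗ.[ℂ] Fock L a :=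
  UnboundedOp.sum fun i : (ℤˣ × ℤˣ) × (fermiMomenta L a s × fermiMomenta L a s) × ℤ =>
    open Classical in
    UnboundedOp.ofBounded
      (if i.2.1.1.1 + p = i.2.1.2.1 + Pi.single (-s) (2 * Real.pi * i.2.2 / a) then
        (((2 * Real.pi / L) ^ 2 : ℝ) : ℂ) •
          fermionOrder (psiDag r s i.1.1 i.2.1.1 * (pauli μ i.1.1 i.1.2 • psi r s i.1.2 i.2.1.2))
      else 0)

/-- The spin-dependent densities `Ĵ_{r,s,±} = (Ĵ⁰_{r,s} ± Ĵ³_{r,s}) / 2`. -/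
noncomputable def spinDensity (L a : ℝ) (r s α : ℤˣ) (p : Momentum) : Fock L a →ₗ.[ℂ] Fock L a :=
  (1 / 2 : ℂ) • (J L a r s 0 p + (sgn α : ℂ) • J L a r s 3 p)

/-- The spin operators `Ŝⁱ_{r,s} = Ĵⁱ_{r,s} / 2`, where `i = 0, 1, 2` stands for the three space
directions. -/
noncomputable def spinOp (L a : ℝ) (r s : ℤˣ) (i : Fin 3) (p : Momentum) : Fock L a →ₗ.[ℂ] Fock L a :=
  (1 / 2 : ℂ) • J L a r s i.succ p

/-- Boson normal ordering of the product `A(p) B(p')` of two nodal densities of flavor `(r, s)`. -/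
noncomputable def bosonOrder (r s : ℤˣ) (A B : Momentum → (Fock L a →ₗ.[ℂ] Fock L a))
    (p p' : Momentum) : Fock L a →ₗ.[ℂ] Fock L a :=
  open Classical in
  if sgn r * p s < 0 then UnboundedOp.mul (A p) (B p') else UnboundedOp.mul (B p') (A p)

/-- The boson normal ordered product `A†A`, where `A†A` is short for `A(-p) A(p)`. -/
noncomputable def orderedSquare (r s : ℤˣ) (A : Momentum → (Fock L a →ₗ.[ℂ] Fock L a))
    (p : Momentum) : Fock L a →ₗ.[ℂ] Fock L a :=
  bosonOrder r s A A (-p) p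

/-- The normal ordered nodal kinetic energy
`∑_α ∑_k (2π/L)² r kₛ :ψ̂†_{r,s,α}(k) ψ̂_{r,s,α}(k):`. -/
noncomputable def kineticEnergy (L a : ℝ) (r s : ℤˣ) : Fock L a →ₗ.[ℂ] Fock L a :=
  UnboundedOp.sum fun i : ℤˣ × fermiMomenta L a s =>
    UnboundedOp.ofBounded
      ((((2 * Real.pi / L) ^ 2 * (sgn r * i.2.1 s) : ℝ) : ℂ) •
        fermionOrder (psiDag r s i.1 i.2 * psi r s i.1 i.2))

/-- `ã π ∑_α ∑_p L⁻² ××Ĵ†_{r,s,α} Ĵ_{r,s,α}××`. -/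
noncomputable def kronigForm (L a : ℝ) (r s : ℤˣ) : Fock L a →ₗ.[ℂ] Fock L a :=
  ((a * Real.pi : ℝ) : ℂ) •
    UnboundedOp.sum fun i : ℤˣ × bosonMomenta L a s =>
      ((1 / L ^ 2 : ℝ) : ℂ) • orderedSquare r s (spinDensity L a r s i.1) i.2.1

/-- `ã π ∑_p L⁻² ××(½ Ĵ†_{r,s} Ĵ_{r,s} + ⅔ Ŝ†_{r,s} · Ŝ_{r,s})××`. -/
noncomputable def sugawaraForm (L a : ℝ) (r s : ℤˣ) : Fock L a →ₗ.[ℂ] Fock L a :=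
  ((a * Real.pi : ℝ) : ℂ) •
    UnboundedOp.sum fun p : bosonMomenta L a s =>
      ((1 / L ^ 2 : ℝ) : ℂ) •
        ((1 / 2 : ℂ) • orderedSquare r s (J L a r s 0) p.1 +
          (2 / 3 : ℂ) • ∑ i : Fin 3, orderedSquare r s (spinOp L a r s i) p.1)

end Nodal

/-!
In integer coordinates, in which the energy of a mode is `(2π/L)(m + 1/2)`, the modes of flavor
`(r, s)` form a lattice `ℤ × ZMod M` with spin, whose transverse component is cyclic because
momentum is conserved modulo `2π/ã`; the densities are translation operators on it. The boson
normal ordered square of a density splits into a quadratic and a quartic part. If the spin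
matrices have the exchange symmetry and the unit sum of squares shared by the pairs of spin
projections and by the Sugawara combination, the quartic part cancels against itself by
antisymmetry, while the quadratic part counts the translations across the Fermi level and hence
gives the energy. Finite particle states are confined to a finite window of energies, so that all
series are finite sums on them. The kinetic energy is diagonal in the number basis, hence
self-adjoint with the number basis spanning a core, and the other two forms are symmetric
extensions of its restriction to that core.
-/

namespace UnboundedOp

variable {F : Type*} [NormedAddCommGroup F] [InnerProductSpace ℂ F]

section Graph

variable {S T : F →ₗ.[ℂ] F} {η ζ : F}

theorem mem_graph_iff_exists : (η, ζ) ∈ T.graph ↔ ∃ h : η ∈ T.domain, T ⟨η, h⟩ = ζ := by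
  rw [LinearPMap.mem_graph_iff]
  constructor
  · rintro ⟨y, rfl, rfl⟩
    exact ⟨y.2, rfl⟩
  · rintro ⟨h, rfl⟩
    exact ⟨⟨η, h⟩, rfl, rfl⟩

theorem mem_graph_ofBounded {A : F →L[ℂ] F} : (η, ζ) ∈ (ofBounded A).graph ↔ A η = ζ := by
  rw [mem_graph_iff_exists]
  exact ⟨fun h => h.2, fun h => ⟨Submodule.mem_top, h⟩⟩

theorem mem_graph_mul :
    (η, ζ) ∈ (mul S T).graph ↔ ∃ ξ, (η, ξ) ∈ T.graph ∧ (ξ, ζ) ∈ S.graph := by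
  simp only [mem_graph_iff_exists]
  constructor
  · rintro ⟨⟨h, h'⟩, rfl⟩
    exact ⟨_, ⟨h, rfl⟩, ⟨h', rfl⟩⟩
  · rintro ⟨_, ⟨h, rfl⟩, ⟨h', rfl⟩⟩
    exact ⟨⟨h, h'⟩, rfl⟩

theorem mem_graph_sum {ι : Type*} {T : ι → (F →ₗ.[ℂ] F)} :
    (η, ζ) ∈ (sum T).graph ↔ ∃ f : ι → F, (∀ i, (η, f i) ∈ (T i).graph) ∧ HasSum f ζ := by
  simp only [mem_graph_iff_exists]
  constructor
  · rintro ⟨⟨h, h'⟩, rfl⟩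
    exact ⟨fun i => T i ⟨η, h i⟩, fun i => ⟨h i, rfl⟩, h'.hasSum⟩
  · rintro ⟨f, hf, hs⟩
    choose h hfe using hf
    obtain rfl : (fun i => T i ⟨η, h i⟩) = f := funext hfe
    exact ⟨⟨h, hs.summable⟩, hs.tsum_eq⟩

theorem mem_graph_add :
    (η, ζ) ∈ (S + T).graph ↔
      ∃ ξ ξ', (η, ξ) ∈ S.graph ∧ (η, ξ') ∈ T.graph ∧ ξ + ξ' = ζ := by
  simp only [mem_graph_iff_exists]
  constructor
  · rintro ⟨⟨h, h'⟩, rfl⟩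
    exact ⟨_, _, ⟨h, rfl⟩, ⟨h', rfl⟩, rfl⟩
  · rintro ⟨_, _, ⟨h, rfl⟩, ⟨h', rfl⟩, rfl⟩
    exact ⟨⟨h, h'⟩, rfl⟩

theorem mem_graph_smul {c : ℂ} :
    (η, ζ) ∈ (c • T).graph ↔ ∃ ξ, (η, ξ) ∈ T.graph ∧ c • ξ = ζ := by
  simp only [mem_graph_iff_exists]
  constructor
  · rintro ⟨h, rfl⟩
    exact ⟨_, ⟨h, rfl⟩, rfl⟩
  · rintro ⟨_, ⟨h, rfl⟩, rfl⟩
    exact ⟨h, rfl⟩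

theorem mem_graph_finsetSum {ι : Type*} {T : ι → (F →ₗ.[ℂ] F)} {f : ι → F} (s : Finset ι)
    (h : ∀ i ∈ s, (η, f i) ∈ (T i).graph) : (η, ∑ i ∈ s, f i) ∈ (∑ i ∈ s, T i).graph := by
  classical
  induction s using Finset.induction_on with
  | empty => exact mem_graph_iff_exists.2 ⟨Submodule.mem_top, rfl⟩
  | insert i s hi ih =>
    rw [Finset.sum_insert hi, Finset.sum_insert hi]
    exact mem_graph_add.2 ⟨_, _, h i (Finset.mem_insert_self i s),
      ih fun j hj => h j (Finset.mem_insert_of_mem hj), rfl⟩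

end Graph

section FormalAdjoint

variable {S S' T T' : F →ₗ.[ℂ] F}

theorem isFormalAdjoint_iff :
    T.IsFormalAdjoint S ↔
      ∀ η ξ φ ζ, (η, ξ) ∈ T.graph → (φ, ζ) ∈ S.graph → ⟪ξ, φ⟫_ℂ = ⟪η, ζ⟫_ℂ := by
  simp only [mem_graph_iff_exists]
  constructor
  · rintro h η _ φ _ ⟨hη, rfl⟩ ⟨hφ, rfl⟩
    exact h ⟨η, hη⟩ ⟨φ, hφ⟩
  · intro h x y
    exact h _ _ _ _ ⟨x.2, rfl⟩ ⟨y.2, rfl⟩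

theorem isFormalAdjoint_ofBounded [CompleteSpace F] (A : F →L[ℂ] F) :
    (ofBounded A).IsFormalAdjoint (ofBounded (star A)) := fun x y =>
  (A.adjoint_inner_right x.1 y.1).symm

theorem isFormalAdjoint_smul (h : T.IsFormalAdjoint T') (c : ℝ) :
    ((c : ℂ) • T).IsFormalAdjoint ((c : ℂ) • T') := fun x y => by
  rw [LinearPMap.smul_apply, LinearPMap.smul_apply, inner_smul_left, inner_smul_right,
    Complex.conj_ofReal, h x y]

theorem isFormalAdjoint_add (hS : S.IsFormalAdjoint S') (hT : T.IsFormalAdjoint T') :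
    (S + T).IsFormalAdjoint (S' + T') := fun x y => by
  rw [LinearPMap.add_apply, LinearPMap.add_apply, inner_add_left, inner_add_right]
  exact congrArg₂ (· + ·) (hS ⟨x, x.2.1⟩ ⟨y, y.2.1⟩) (hT ⟨x, x.2.2⟩ ⟨y, y.2.2⟩)

theorem isFormalAdjoint_finsetSum {ι : Type*} {T T' : ι → (F →ₗ.[ℂ] F)} (s : Finset ι)
    (h : ∀ i ∈ s, (T i).IsFormalAdjoint (T' i)) :
    (∑ i ∈ s, T i).IsFormalAdjoint (∑ i ∈ s, T' i) := by
  classical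
  induction s using Finset.induction_on with
  | empty =>
    intro x y
    exact (inner_zero_left _).trans (inner_zero_right _).symm
  | insert i s hi ih =>
    rw [Finset.sum_insert hi, Finset.sum_insert hi]
    exact isFormalAdjoint_add (h i (Finset.mem_insert_self i s))
      (ih fun j hj => h j (Finset.mem_insert_of_mem hj))

theorem isFormalAdjoint_mul (hS : S.IsFormalAdjoint S') (hT : T.IsFormalAdjoint T') :
    (mul S T).IsFormalAdjoint (mul T' S') := by
  rw [isFormalAdjoint_iff] at hS hT ⊢
  intro η ξ φ ζ h h'
  obtain ⟨ξ₁, h₁, h₂⟩ := mem_graph_mul.1 h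
  obtain ⟨ζ₁, h₁', h₂'⟩ := mem_graph_mul.1 h'
  rw [hS _ _ _ _ h₂ h₁', hT _ _ _ _ h₁ h₂']

theorem isFormalAdjoint_sum {ι : Type*} {T T' : ι → (F →ₗ.[ℂ] F)}
    (h : ∀ i, (T i).IsFormalAdjoint (T' i)) : (sum T).IsFormalAdjoint (sum T') := by
  simp only [isFormalAdjoint_iff] at h ⊢
  intro η ξ φ ζ hη hφ
  obtain ⟨f, hf, hsf⟩ := mem_graph_sum.1 hη
  obtain ⟨g, hg, hsg⟩ := mem_graph_sum.1 hφ
  have hleft : HasSum (fun i => ⟪f i, φ⟫_ℂ) ⟪ξ, φ⟫_ℂ := by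
    simpa only [innerSL_apply_apply, Function.comp_def, inner_conj_symm] using
      (hsf.mapL (innerSL ℂ φ)).map (starRingEnd ℂ) Complex.continuous_conj
  have hright : HasSum (fun i => ⟪η, g i⟫_ℂ) ⟪η, ζ⟫_ℂ := hsg.mapL (innerSL ℂ η)
  refine hleft.unique ?_
  simpa only [h _ _ _ _ _ (hf _) (hg _)] using hright

theorem sum_comp_equiv {ι κ : Type*} (e : ι ≃ κ) (T : κ → (F →ₗ.[ℂ] F)) :
    sum (fun i => T (e i)) = sum T := by
  refine LinearPMap.eq_of_eq_graph ?_
  ext ⟨η, ζ⟩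
  rw [mem_graph_sum, mem_graph_sum]
  constructor
  · rintro ⟨f, hf, hs⟩
    refine ⟨f ∘ e.symm, fun i => ?_, e.symm.hasSum_iff.2 hs⟩
    simpa using hf (e.symm i)
  · rintro ⟨f, hf, hs⟩
    exact ⟨f ∘ e, fun i => hf (e i), e.hasSum_iff.2 hs⟩

end FormalAdjoint

/-! ### Diagonal operators -/

/-- `T` is the diagonal operator with eigenvalues `E` in the Hilbert basis `b`, on its maximal
domain. -/
def IsDiagonal {κ : Type*} (b : HilbertBasis κ ℂ F) (E : κ → ℝ) (T : F →ₗ.[ℂ] F) : Prop :=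
  ∀ η ξ, (η, ξ) ∈ T.graph ↔ ∀ k, b.repr ξ k = E k * b.repr η k

namespace IsDiagonal

variable {κ : Type*} {b : HilbertBasis κ ℂ F} {E : κ → ℝ} {S T : F →ₗ.[ℂ] F}

theorem basis_mem_graph (hT : IsDiagonal b E T) (k : κ) : (b k, (E k : ℂ) • b k) ∈ T.graph := by
  classical
  refine (hT _ _).2 fun j => ?_
  rw [map_smul, lp.coeFn_smul, Pi.smul_apply, b.repr_self, lp.single_apply, Pi.single_apply]
  split_ifs with h
  · rw [h, smul_eq_mul]
  · rw [smul_zero, mul_zero]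

theorem dense_domain (hT : IsDiagonal b E T) : Dense (T.domain : Set F) := by
  have hspan : Submodule.span ℂ (Set.range b) ≤ T.domain := by
    rw [Submodule.span_le, Set.range_subset_iff]
    exact fun k => (mem_graph_iff_exists.1 (hT.basis_mem_graph k)).1
  exact (Submodule.dense_iff_topologicalClosure_eq_top.2 b.dense_span).mono hspan

theorem isFormalAdjoint_self (hT : IsDiagonal b E T) : T.IsFormalAdjoint T := by
  refine isFormalAdjoint_iff.2 fun η ξ φ ζ h h' => ?_
  rw [← b.repr.inner_map_map ξ, ← b.repr.inner_map_map η, lp.inner_eq_tsum, lp.inner_eq_tsum]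
  refine tsum_congr fun k => ?_
  rw [(hT _ _).1 h k, (hT _ _).1 h' k]
  simp only [RCLike.inner_apply, map_mul, Complex.conj_ofReal]
  ring

theorem le_of_isFormalAdjoint (hT : IsDiagonal b E T)
    (hb : ∀ k, (b k, (E k : ℂ) • b k) ∈ S.graph) {S' : F →ₗ.[ℂ] F} (hS : S'.IsFormalAdjoint S) :
    S' ≤ T := by
  refine LinearPMap.le_of_le_graph ?_
  rintro ⟨η, ξ⟩ h
  refine (hT _ _).2 fun k => ?_
  have hk := isFormalAdjoint_iff.1 hS.symm _ _ _ _ (hb k) h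
  rw [inner_smul_left, Complex.conj_ofReal] at hk
  rw [b.repr_apply_apply, b.repr_apply_apply, hk]

theorem isSelfAdjoint [CompleteSpace F] (hT : IsDiagonal b E T) : IsSelfAdjoint T := by
  rw [LinearPMap.isSelfAdjoint_def]
  exact le_antisymm
    (hT.le_of_isFormalAdjoint hT.basis_mem_graph (T.adjoint_isFormalAdjoint hT.dense_domain))
    (hT.isFormalAdjoint_self.le_adjoint hT.dense_domain)

theorem graph_le_topologicalClosure (hT : IsDiagonal b E T)
    (hb : ∀ k, (b k, (E k : ℂ) • b k) ∈ S.graph) : T.graph ≤ S.graph.topologicalClosure := by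
  rintro ⟨η, ξ⟩ h
  have hsum : HasSum (fun k => (b.repr η k • b k, b.repr ξ k • b k)) (η, ξ) :=
    (b.hasSum_repr η).prodMk (b.hasSum_repr ξ)
  refine mem_closure_of_tendsto hsum (.of_forall fun s => Submodule.sum_mem _ fun k _ => ?_)
  rw [(hT _ _).1 h k, mul_comm, mul_smul]
  exact Submodule.smul_mem _ _ (hb k)

theorem closure_eq [CompleteSpace F] (hT : IsDiagonal b E T)
    (hb : ∀ k, (b k, (E k : ℂ) • b k) ∈ S.graph) (hS : S.IsFormalAdjoint S) : S.closure = T := by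
  have hle : S ≤ T := hT.le_of_isFormalAdjoint hb hS
  have hclosed : T.IsClosed := hT.isSelfAdjoint.isClosed
  have hgraph := (hclosed.isClosable.leIsClosable hle).graph_closure_eq_closure_graph
  refine le_antisymm (LinearPMap.le_of_le_graph ?_) (LinearPMap.le_of_le_graph ?_)
  · rw [← hgraph]
    exact Submodule.topologicalClosure_minimal _ (LinearPMap.le_graph_of_le hle) hclosed
  · rw [← hgraph]
    exact hT.graph_le_topologicalClosure hb

end IsDiagonal

section SumDiagonal

variable {ι κ : Type*} {b : HilbertBasis κ ℂ F} {E : κ → ℝ} {A : ι → F →L[ℂ] F} {e : ι → κ → ℝ}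

theorem hasSum_norm_repr_sq (b : HilbertBasis κ ℂ F) (η : F) :
    HasSum (fun k => ‖b.repr η k‖ ^ 2) (‖η‖ ^ 2) := by
  have h := lp.hasSum_norm (p := 2) (by norm_num) (b.repr η)
  simpa [b.repr.norm_map] using h

theorem repr_apply_of_basis {B : F →L[ℂ] F} {c : κ → ℝ} (hB : ∀ k, B (b k) = (c k : ℂ) • b k)
    (η : F) (k : κ) : b.repr (B η) k = c k * b.repr η k := by
  classical
  have h : HasSum (fun j => b.repr η j • (c j : ℂ) • b j) (B η) := by
    simpa only [map_smul, hB] using (b.hasSum_repr η).mapL B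
  have h' := h.mapL (innerSL ℂ (b k))
  simp only [innerSL_apply_apply, inner_smul_right, orthonormal_iff_ite.1 b.orthonormal] at h'
  rw [b.repr_apply_apply (B η), h'.unique (hasSum_single k fun j hj => ?_), if_pos rfl, mul_one,
    mul_comm]
  rw [if_neg hj.symm, mul_zero, mul_zero]

theorem hasSum_of_repr (he : ∀ i k, 0 ≤ e i k) (hE : ∀ k, HasSum (e · k) (E k))
    (hA : ∀ i k, A i (b k) = (e i k : ℂ) • b k) {η ξ : F}
    (hξ : ∀ k, b.repr ξ k = E k * b.repr η k) : HasSum (fun i => A i η) ξ := by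
  have hpart (t : Finset ι) (k : κ) :
      b.repr (∑ i ∈ t, A i η - ξ) k = ((∑ i ∈ t, e i k - E k : ℝ) : ℂ) * b.repr η k := by
    rw [map_sub, map_sum, lp.coeFn_sub, Pi.sub_apply, lp.coeFn_sum, Finset.sum_apply, hξ]
    simp only [repr_apply_of_basis (hA _), ← Finset.sum_mul, Complex.ofReal_sub,
      Complex.ofReal_sum, sub_mul]
  have hbound (t : Finset ι) (k : κ) : ‖b.repr (∑ i ∈ t, A i η - ξ) k‖ ^ 2 ≤ ‖b.repr ξ k‖ ^ 2 := by
    have hle : ∑ i ∈ t, e i k ≤ E k := sum_le_hasSum t (fun i _ => he i k) (hE k)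
    have hnonneg : 0 ≤ ∑ i ∈ t, e i k := Finset.sum_nonneg fun i _ => he i k
    rw [hpart, hξ, norm_mul, norm_mul, Complex.norm_real, Complex.norm_real, Real.norm_eq_abs,
      Real.norm_eq_abs, abs_of_nonpos (sub_nonpos.2 hle), abs_of_nonneg (hnonneg.trans hle)]
    gcongr
    · exact mul_nonneg (by linarith) (norm_nonneg _)
    · linarith
  have hlim (k : κ) : Filter.Tendsto (fun t : Finset ι => ‖b.repr (∑ i ∈ t, A i η - ξ) k‖ ^ 2)
      Filter.atTop (nhds 0) := by
    have h : Filter.Tendsto (fun t : Finset ι => ∑ i ∈ t, e i k - E k) Filter.atTop (nhds 0) := by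
      simpa using (hE k).sub_const (E k)
    simp only [hpart, norm_mul, Complex.norm_real, mul_pow]
    simpa using (h.norm.pow 2).mul_const (‖b.repr η k‖ ^ 2)
  have hnorm : Filter.Tendsto (fun t : Finset ι => ‖∑ i ∈ t, A i η - ξ‖ ^ 2)
      Filter.atTop (nhds 0) := by
    have h := tendsto_tsum_of_dominated_convergence (hasSum_norm_repr_sq b ξ).summable hlim
      (.of_forall fun t k => by rw [norm_pow, norm_norm]; exact hbound t k)
    simpa only [(hasSum_norm_repr_sq b _).tsum_eq, tsum_zero] using h
  have hsqrt := (Real.continuous_sqrt.tendsto 0).comp hnorm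
  rw [HasSum, SummationFilter.unconditional_filter, tendsto_iff_norm_sub_tendsto_zero]
  simpa [Function.comp_def, Real.sqrt_sq] using hsqrt

theorem isDiagonal_sum (he : ∀ i k, 0 ≤ e i k) (hE : ∀ k, HasSum (e · k) (E k))
    (hA : ∀ i k, A i (b k) = (e i k : ℂ) • b k) :
    IsDiagonal b E (sum fun i => ofBounded (A i)) := by
  intro η ξ
  simp only [mem_graph_sum, mem_graph_ofBounded]
  constructor
  · rintro ⟨f, hf, hs⟩ k
    obtain rfl : (fun i => A i η) = f := funext hf
    have hrepr := hs.mapL (innerSL ℂ (b k))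
    simp only [innerSL_apply_apply, ← b.repr_apply_apply, repr_apply_of_basis (hA _)] at hrepr
    exact hrepr.unique ((Complex.hasSum_ofReal.2 (hE k)).mul_right _)
  · exact fun h => ⟨fun i => A i η, fun i => rfl, hasSum_of_repr he hE hA h⟩

end SumDiagonal

end UnboundedOp

/-! ### Canonical anticommutation relations -/

/-- The canonical anticommutation relations of annihilators `c` and creators `c'`. -/
structure IsCAR {ι A : Type*} [DecidableEq ι] [Ring A] (c c' : ι → A) : Prop where
  ann_ann : ∀ i j, c i * c j + c j * c i = 0
  cre_cre : ∀ i j, c' i * c' j + c' j * c' i = 0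
  ann_cre : ∀ i j, c i * c' j + c' j * c i = if i = j then 1 else 0

namespace IsCAR

variable {ι κ A : Type*} [DecidableEq ι] [DecidableEq κ] [Ring A] {c c' : ι → A}

theorem comp_injective (h : IsCAR c c') {f : κ → ι} (hf : f.Injective) :
    IsCAR (fun k => c (f k)) fun k => c' (f k) where
  ann_ann _ _ := h.ann_ann _ _
  cre_cre _ _ := h.cre_cre _ _
  ann_cre _ _ := (h.ann_cre _ _).trans (if_congr hf.eq_iff rfl rfl)

theorem ann_mul_ann (h : IsCAR c c') (i j : ι) : c i * c j = -(c j * c i) :=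
  eq_neg_of_add_eq_zero_left (h.ann_ann i j)

theorem cre_mul_cre (h : IsCAR c c') (i j : ι) : c' i * c' j = -(c' j * c' i) :=
  eq_neg_of_add_eq_zero_left (h.cre_cre i j)

theorem ann_mul_cre (h : IsCAR c c') (i j : ι) :
    c i * c' j = (if i = j then 1 else 0) - c' j * c i :=
  eq_sub_of_add_eq (h.ann_cre i j)

theorem cre_mul_ann (h : IsCAR c c') (i j : ι) :
    c' i * c j = (if i = j then 1 else 0) - c j * c' i :=
  eq_sub_of_add_eq' ((h.ann_cre j i).trans (if_congr eq_comm rfl rfl))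

theorem bilin_mul_bilin (h : IsCAR c c') (i j k l : ι) :
    c' i * c j * (c' k * c l) = (if j = k then c' i * c l else 0) + c' i * c' k * (c l * c j) := by
  calc c' i * c j * (c' k * c l) = c' i * (c j * c' k) * c l := by noncomm_ring
    _ = c' i * ((if j = k then 1 else 0) - c' k * c j) * c l := by rw [h.ann_mul_cre]
    _ = (if j = k then c' i * c l else 0) - c' i * c' k * (c j * c l) := by
      split_ifs <;> noncomm_ring
    _ = _ := by rw [h.ann_mul_ann j l, mul_neg, sub_neg_eq_add]

theorem particleHole (h : IsCAR c c') (p : ι → Prop) [DecidablePred p] :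
    IsCAR (fun i => if p i then c i else c' i) fun i => if p i then c' i else c i where
  ann_ann i j := by
    split_ifs with hi hj hj
    · exact h.ann_ann i j
    · rw [h.ann_cre, if_neg (by rintro rfl; exact hj hi)]
    · rw [add_comm, h.ann_cre, if_neg (by rintro rfl; exact hi hj)]
    · exact h.cre_cre i j
  cre_cre i j := by
    split_ifs with hi hj hj
    · exact h.cre_cre i j
    · rw [add_comm, h.ann_cre, if_neg (by rintro rfl; exact hj hi)]
    · rw [h.ann_cre, if_neg (by rintro rfl; exact hi hj)]
    · exact h.ann_ann i j
  ann_cre i j := by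
    split_ifs with hi hj hij hij hj hij hij
    · rw [h.ann_cre, if_pos hij]
    · rw [h.ann_cre, if_neg hij]
    · exact absurd (hij ▸ hi) hj
    · exact h.ann_ann i j
    · exact absurd (hij ▸ hj) hi
    · exact h.cre_cre i j
    · rw [add_comm, h.ann_cre, if_pos hij.symm]
    · rw [add_comm, h.ann_cre, if_neg (Ne.symm hij)]

end IsCAR

namespace FermionFock

variable {ι : Type*}

/-- The number basis as a Hilbert basis of the Fock space. -/
noncomputable def numberBasis (ι : Type*) : HilbertBasis (Finset ι) ℂ (FermionFock ι) :=
  ⟨LinearIsometryEquiv.refl ℂ _⟩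

theorem numberBasis_repr_apply (f : FermionFock ι) (S : Finset ι) :
    (numberBasis ι).repr f S = f S := rfl

theorem numberBasis_apply (S : Finset ι) : numberBasis ι S = basisVec S := by
  classical
  rw [← (numberBasis ι).repr_symm_single, basisVec]
  congr!

theorem basisVec_apply (S T : Finset ι) [Decidable (T = S)] :
    (basisVec S : FermionFock ι) T = if T = S then 1 else 0 := by
  classical
  rw [basisVec, lp.single_apply, Pi.single_apply]
  congr!

theorem inner_basisVec_left (S : Finset ι) (f : FermionFock ι) : ⟪basisVec S, f⟫_ℂ = f S := by
  rw [← numberBasis_apply, ← (numberBasis ι).repr_apply_apply, numberBasis_repr_apply]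

variable [LinearOrder ι]

theorem jwSign_mul_self (q : ι) (S : Finset ι) : jwSign q S * jwSign q S = 1 := by
  rw [jwSign, ← mul_pow, neg_one_mul, neg_neg, one_pow]

theorem conj_jwSign (q : ι) (S : Finset ι) : starRingEnd ℂ (jwSign q S) = jwSign q S := by
  simp [jwSign]

theorem jwSign_insert_self (q : ι) (S : Finset ι) : jwSign q (insert q S) = jwSign q S := by
  rw [jwSign, jwSign, Finset.filter_insert, if_neg (lt_irrefl q)]

theorem jwSign_erase_self (q : ι) (S : Finset ι) : jwSign q (S.erase q) = jwSign q S := by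
  by_cases h : q ∈ S
  · rw [← jwSign_insert_self, Finset.insert_erase h]
  · rw [Finset.erase_eq_of_notMem h]

theorem jwSign_insert {q q' : ι} {S : Finset ι} (h : q' ∉ S) :
    jwSign q (insert q' S) = (if q' < q then -1 else 1) * jwSign q S := by
  unfold jwSign
  rw [Finset.filter_insert]
  split_ifs with hq
  · rw [Finset.card_insert_of_notMem (by simp [h]), pow_succ']
  · rw [one_mul]

theorem jwSign_mul_jwSign_insert {q q' : ι} {S : Finset ι} (hne : q ≠ q') (h : q ∉ S)
    (h' : q' ∉ S) :
    jwSign q S * jwSign q' (insert q S) = -(jwSign q' S * jwSign q (insert q' S)) := by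
  rw [jwSign_insert h, jwSign_insert h']
  rcases lt_or_gt_of_ne hne with hlt | hlt <;> rw [if_pos hlt, if_neg hlt.not_gt] <;> ring

theorem jwSign_insert_mul_jwSign_insert {q q' : ι} {S : Finset ι} (hne : q ≠ q') (h : q ∉ S)
    (h' : q' ∉ S) :
    jwSign q (insert q' S) * jwSign q' (insert q S) = -(jwSign q' S * jwSign q S) := by
  rw [jwSign_insert h, jwSign_insert h']
  rcases lt_or_gt_of_ne hne with hlt | hlt <;> rw [if_pos hlt, if_neg hlt.not_gt] <;> ring

theorem ann_apply (q : ι) (f : FermionFock ι) (S : Finset ι) :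
    ann q f S = if q ∈ S then 0 else jwSign q S * f (insert q S) := rfl

theorem ann_basisVec (q : ι) (S : Finset ι) :
    ann q (basisVec S) = if q ∈ S then jwSign q S • basisVec (S.erase q) else 0 := by
  ext T
  rw [ann_apply, basisVec_apply]
  by_cases hT : q ∈ T
  · have hne : T ≠ S.erase q := fun h => Finset.notMem_erase q S (h ▸ hT)
    rw [if_pos hT]
    split_ifs
    · rw [lp.coeFn_smul, Pi.smul_apply, basisVec_apply, if_neg hne, smul_zero]
    · rfl
  · rw [if_neg hT]
    by_cases hS : q ∈ S
    · have hiff : insert q T = S ↔ T = S.erase q :=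
        ⟨fun h => by rw [← h, Finset.erase_insert hT], fun h => by rw [h, Finset.insert_erase hS]⟩
      rw [if_pos hS, lp.coeFn_smul, Pi.smul_apply, basisVec_apply, smul_eq_mul]
      simp only [hiff]
      split_ifs with h
      · rw [h, jwSign_erase_self]
      · rw [mul_zero, mul_zero]
    · have hne : insert q T ≠ S := fun h => hS (h ▸ Finset.mem_insert_self q T)
      rw [if_neg hS, if_neg hne, mul_zero]
      rfl

theorem star_ann_apply (q : ι) (f : FermionFock ι) (S : Finset ι) :
    star (ann q) f S = if q ∈ S then jwSign q S * f (S.erase q) else 0 := by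
  rw [← inner_basisVec_left, ContinuousLinearMap.star_eq_adjoint,
    ContinuousLinearMap.adjoint_inner_right, ann_basisVec]
  split_ifs
  · rw [inner_smul_left, conj_jwSign, inner_basisVec_left]
  · rw [inner_zero_left]

theorem ann_mul_ann (q q' : ι) : ann q * ann q' + ann q' * ann q = 0 := by
  ext f S
  change ann q (ann q' f) S + ann q' (ann q f) S = 0
  rw [ann_apply, ann_apply, ann_apply, ann_apply]
  by_cases hne : q = q'
  · simp [hne]
  by_cases h : q ∈ S
  · simp [h]
  by_cases h' : q' ∈ S
  · simp [h']
  have hq : q ∉ insert q' S := by simp [h, hne]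
  have hq' : q' ∉ insert q S := by simp [h', Ne.symm hne]
  rw [if_neg h, if_neg h', if_neg hq, if_neg hq', Finset.insert_comm q' q, ← mul_assoc,
    ← mul_assoc, jwSign_mul_jwSign_insert hne h h']
  ring

theorem ann_mul_star_ann_self (q : ι) : ann q * star (ann q) + star (ann q) * ann q = 1 := by
  ext f S
  change ann q (star (ann q) f) S + star (ann q) (ann q f) S = f S
  rw [ann_apply, star_ann_apply, star_ann_apply, ann_apply, if_pos (Finset.mem_insert_self _ _),
    if_neg (Finset.notMem_erase _ _), jwSign_insert_self, jwSign_erase_self, ← mul_assoc,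
    ← mul_assoc, jwSign_mul_self, one_mul, one_mul]
  split_ifs with h
  · rw [zero_add, Finset.insert_erase h]
  · rw [add_zero, Finset.erase_insert h]

theorem ann_mul_star_ann_of_ne {q q' : ι} (hne : q ≠ q') :
    ann q * star (ann q') + star (ann q') * ann q = 0 := by
  ext f S
  change ann q (star (ann q') f) S + star (ann q') (ann q f) S = 0
  rw [ann_apply, star_ann_apply, star_ann_apply, ann_apply]
  by_cases h' : q' ∈ S
  · by_cases h : q ∈ S
    · simp [h, hne]
    obtain ⟨U, hU, rfl⟩ : ∃ U, q' ∉ U ∧ insert q' U = S :=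
      ⟨S.erase q', Finset.notMem_erase _ _, Finset.insert_erase h'⟩
    have hq : q ∉ U := fun hq => h (Finset.mem_insert_of_mem hq)
    have hq' : q' ∉ insert q U := by simp [hU, Ne.symm hne]
    rw [if_neg h, if_pos (Finset.mem_insert_of_mem h'), if_pos h', Finset.insert_comm q q',
      Finset.erase_insert hq', Finset.erase_insert hU, if_neg hq, jwSign_insert_self,
      jwSign_insert_self, ← mul_assoc, ← mul_assoc, jwSign_insert_mul_jwSign_insert hne hq hU]
    ring
  · simp [h', Ne.symm hne]

theorem isCAR_ann : IsCAR (ann (ι := ι)) fun q => star (ann q) where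
  ann_ann := ann_mul_ann
  cre_cre q q' := by rw [← star_mul, ← star_mul, ← star_add, ann_mul_ann, star_zero]
  ann_cre q q' := by
    split_ifs with h
    · rw [h, ann_mul_star_ann_self]
    · exact ann_mul_star_ann_of_ne h

theorem ann_vacuum (q : ι) : ann q vacuum = 0 := by
  rw [vacuum, ann_basisVec, if_neg (Finset.notMem_empty q)]

theorem number_basisVec (q : ι) (S : Finset ι) :
    (star (ann q) * ann q) (basisVec S) = (if q ∈ S then (1 : ℂ) else 0) • basisVec S := by
  ext T
  change star (ann q) (ann q (basisVec S)) T = _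
  rw [star_ann_apply, ann_apply, if_neg (Finset.notMem_erase _ _), jwSign_erase_self, ← mul_assoc,
    jwSign_mul_self, one_mul, lp.coeFn_smul, Pi.smul_apply, basisVec_apply, basisVec_apply]
  by_cases hT : T = S
  · subst hT
    by_cases h : q ∈ T
    · simp [h, Finset.insert_erase h]
    · simp [h]
  · by_cases h : q ∈ T
    · simp [h, hT, Finset.insert_erase h]
    · simp [h, hT]

open Classical in
/-- The annihilators `c` of Dirac's picture: relative to the empty state, the modes in `P` are
particles and the remaining ones are holes, so that the vacuum is a filled sea. -/
noncomputable def diracAnn (P : Set ι) (q : ι) : FermionFock ι →L[ℂ] FermionFock ι :=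
  if q ∈ P then ann q else star (ann q)

open Classical in
theorem isCAR_diracAnn (P : Set ι) : IsCAR (diracAnn P) fun q => star (diracAnn P q) := by
  have h (q : ι) : star (diracAnn P q) = if q ∈ P then star (ann q) else ann q := by
    rw [diracAnn]
    split_ifs
    · rfl
    · exact star_star _
  simp only [h]
  exact isCAR_ann.particleHole (· ∈ P)

theorem diracAnn_vacuum {P : Set ι} {q : ι} (h : q ∈ P) : diracAnn P q vacuum = 0 := by
  rw [diracAnn, if_pos h, ann_vacuum]

theorem star_diracAnn_vacuum {P : Set ι} {q : ι} (h : q ∉ P) : star (diracAnn P q) vacuum = 0 := by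
  rw [diracAnn, if_neg h, star_star, ann_vacuum]

theorem inner_vacuum_self : ⟪(vacuum : FermionFock ι), vacuum⟫_ℂ = 1 := by
  rw [vacuum, inner_basisVec_left, basisVec_apply, if_pos rfl]

open Classical in
theorem inner_vacuum_diracAnn (P : Set ι) (q q' : ι) :
    ⟪(vacuum : FermionFock ι), (star (diracAnn P q) * diracAnn P q') vacuum⟫_ℂ =
      if q = q' ∧ q ∉ P then 1 else 0 := by
  rw [eq_sub_of_add_eq' ((isCAR_diracAnn P).ann_cre q' q)]
  by_cases hq : q ∈ P
  · rw [← eq_sub_of_add_eq' ((isCAR_diracAnn P).ann_cre q' q), mul_apply_eq_comp,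
      ContinuousLinearMap.star_eq_adjoint, ContinuousLinearMap.adjoint_inner_right,
      diracAnn_vacuum hq, inner_zero_left, if_neg fun h => h.2 hq]
  · rw [sub_apply, mul_apply_eq_comp, star_diracAnn_vacuum hq, map_zero, sub_zero]
    simp only [hq, eq_comm (a := q'), not_false_eq_true, and_true]
    split_ifs
    · exact inner_vacuum_self
    · exact inner_zero_right _

open Classical in
theorem star_diracAnn_mul_self (P : Set ι) (q : ι) :
    star (diracAnn P q) * diracAnn P q - (if q ∈ P then (0 : ℂ) else 1) • 1 =
      (if q ∈ P then (1 : ℂ) else -1) • (star (ann q) * ann q) := by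
  rw [diracAnn]
  split_ifs
  · rw [zero_smul, sub_zero, one_smul]
  · rw [star_star, eq_sub_of_add_eq (ann_mul_star_ann_self q)]
    module

end FermionFock

/-! ### Bilinear and quartic expressions in the modes -/

section CAR

variable {ι A : Type*} [Ring A] [Algebra ℂ A]

/-- The bilinear `∑ B i j c'ᵢ cⱼ` over a finite set of modes. -/
def quad (W : Finset ι) (c c' : ι → A) : (ι → ι → ℂ) →ₗ[ℂ] A where
  toFun B := ∑ i ∈ W, ∑ j ∈ W, B i j • (c' i * c j)
  map_add' B C := by simp only [Pi.add_apply, add_smul, Finset.sum_add_distrib]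
  map_smul' z B := by
    simp only [Pi.smul_apply, smul_eq_mul, mul_smul, Finset.smul_sum, RingHom.id_apply]

/-- The quartic expression `∑ T i j k l c'ᵢ c'ₖ cₗ cⱼ` over a finite set of modes: the first two
indices of `T` belong to one bilinear, the last two to another one. -/
def quartic (W : Finset ι) (c c' : ι → A) : (ι → ι → ι → ι → ℂ) →ₗ[ℂ] A where
  toFun T := ∑ i ∈ W, ∑ j ∈ W, ∑ k ∈ W, ∑ l ∈ W, T i j k l • (c' i * c' k * (c l * c j))
  map_add' T U := by simp only [Pi.add_apply, add_smul, Finset.sum_add_distrib]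
  map_smul' z T := by
    simp only [Pi.smul_apply, smul_eq_mul, mul_smul, Finset.smul_sum, RingHom.id_apply]

variable {c c' : ι → A} (W : Finset ι)

theorem quad_apply (B : ι → ι → ℂ) :
    quad W c c' B = ∑ i ∈ W, ∑ j ∈ W, B i j • (c' i * c j) := rfl

theorem quartic_apply (T : ι → ι → ι → ι → ℂ) :
    quartic W c c' T =
      ∑ i ∈ W, ∑ j ∈ W, ∑ k ∈ W, ∑ l ∈ W, T i j k l • (c' i * c' k * (c l * c j)) := rfl

theorem quartic_congr {T U : ι → ι → ι → ι → ℂ}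
    (h : ∀ i ∈ W, ∀ j ∈ W, ∀ k ∈ W, ∀ l ∈ W, T i j k l = U i j k l) :
    quartic W c c' T = quartic W c c' U :=
  Finset.sum_congr rfl fun i hi => Finset.sum_congr rfl fun j hj =>
    Finset.sum_congr rfl fun k hk => Finset.sum_congr rfl fun l hl => by rw [h i hi j hj k hk l hl]

variable [DecidableEq ι]

theorem quad_eq_sum_of_diag {B : ι → ι → ℂ} {d : ι → ℂ}
    (hB : ∀ i ∈ W, ∀ j ∈ W, B i j = if i = j then d i else 0) :
    quad W c c' B = ∑ i ∈ W, d i • (c' i * c i) := by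
  refine Finset.sum_congr rfl fun i hi => ?_
  rw [Finset.sum_eq_single_of_mem i hi fun j hj hne => by rw [hB i hi j hj, if_neg hne.symm,
    zero_smul], hB i hi i hi, if_pos rfl]

namespace IsCAR

theorem quad_mul_quad (h : IsCAR c c') (B C : ι → ι → ℂ) :
    quad W c c' B * quad W c c' C =
      quad W c c' (fun i l => ∑ j ∈ W, B i j * C j l) +
        quartic W c c' (fun i j k l => B i j * C k l) := by
  simp only [quad_apply, quartic_apply, Finset.sum_mul]
  simp only [Finset.mul_sum, smul_mul_smul_comm, h.bilin_mul_bilin, smul_add, smul_ite, smul_zero,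
    Finset.sum_add_distrib, Finset.sum_smul]
  congr 1
  refine Finset.sum_congr rfl fun i _ => ?_
  rw [Finset.sum_comm (s := W) (t := W) (f := fun l j => (B i j * C j l) • (c' i * c l))]
  refine Finset.sum_congr rfl fun j hj => ?_
  rw [Finset.sum_comm]
  refine Finset.sum_congr rfl fun l _ => ?_
  rw [Finset.sum_ite_eq, if_pos hj]

theorem quartic_flip (h : IsCAR c c') (T : ι → ι → ι → ι → ℂ) :
    quartic W c c' (fun i j k l => T k l i j) = quartic W c c' T := by
  have hflip (i j k l : ι) : c' i * c' k * (c l * c j) = c' k * c' i * (c j * c l) := by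
    rw [h.cre_mul_cre i k, h.ann_mul_ann l j, neg_mul_neg]
  simp only [quartic_apply]
  calc _ = ∑ i ∈ W, ∑ k ∈ W, ∑ j ∈ W, ∑ l ∈ W, T k l i j • (c' k * c' i * (c j * c l)) := by
        refine Finset.sum_congr rfl fun i _ => ?_
        rw [Finset.sum_comm]
        simp only [hflip]
    _ = ∑ k ∈ W, ∑ i ∈ W, ∑ l ∈ W, ∑ j ∈ W, T k l i j • (c' k * c' i * (c j * c l)) := by
        rw [Finset.sum_comm]
        exact Finset.sum_congr rfl fun k _ => Finset.sum_congr rfl fun i _ => Finset.sum_comm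
    _ = _ := Finset.sum_congr rfl fun k _ => Finset.sum_comm

theorem quartic_swap (h : IsCAR c c') (T : ι → ι → ι → ι → ℂ) :
    quartic W c c' (fun i j k l => T i l k j) = -quartic W c c' T := by
  simp only [quartic_apply, ← Finset.sum_neg_distrib]
  refine Finset.sum_congr rfl fun i _ => ?_
  calc _ = ∑ j ∈ W, ∑ l ∈ W, ∑ k ∈ W, T i l k j • (c' i * c' k * (c l * c j)) :=
        Finset.sum_congr rfl fun j _ => Finset.sum_comm
    _ = ∑ l ∈ W, ∑ j ∈ W, ∑ k ∈ W, T i l k j • (c' i * c' k * (c l * c j)) := Finset.sum_comm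
    _ = _ := by
        refine Finset.sum_congr rfl fun l _ => ?_
        rw [Finset.sum_comm]
        refine Finset.sum_congr rfl fun k _ => Finset.sum_congr rfl fun j _ => ?_
        rw [h.ann_mul_ann l j, mul_neg, smul_neg]

theorem quartic_eq_zero (h : IsCAR c c') {T : ι → ι → ι → ι → ℂ}
    (hT : ∀ i ∈ W, ∀ j ∈ W, ∀ k ∈ W, ∀ l ∈ W,
      T i j k l + T k l i j = T i l k j + T k j i l) : quartic W c c' T = 0 := by
  have hsymm : quartic W c c' (T + fun i j k l => T k l i j) =
      quartic W c c' ((fun i j k l => T i l k j) + fun i j k l => T k j i l) :=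
    quartic_congr W hT
  rw [map_add, map_add, h.quartic_flip W T, h.quartic_swap W T,
    h.quartic_swap W fun i j k l => T k l i j, h.quartic_flip W T] at hsymm
  have hfour : (4 : ℂ) • quartic W c c' T = 0 := by
    calc (4 : ℂ) • quartic W c c' T = (quartic W c c' T + quartic W c c' T) -
          (-quartic W c c' T + -quartic W c c' T) := by module
      _ = 0 := by rw [hsymm, sub_self]
  exact (smul_eq_zero_iff_right (by norm_num)).1 hfour

/-- The quartic parts of the products cancel in the sum by the anticommutation relations, because
the symmetrised coefficients do not change when the annihilators are exchanged. -/
theorem sum_quad_mul_quad (h : IsCAR c c') {κ : Type*} (P : Finset κ) {v : κ → ℂ}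
    {B C : κ → ι → ι → ℂ} {T : ι → ι → ι → ι → ℂ}
    (hBC : ∀ i ∈ W, ∀ j ∈ W, ∀ k ∈ W, ∀ l ∈ W, ∑ p ∈ P, v p * (B p i j * C p k l) = T i j k l)
    (hT : ∀ i ∈ W, ∀ j ∈ W, ∀ k ∈ W, ∀ l ∈ W,
      T i j k l + T k l i j = T i l k j + T k j i l) :
    ∑ p ∈ P, v p • (quad W c c' (B p) * quad W c c' (C p)) =
      quad W c c' fun i l => ∑ j ∈ W, T i j j l := by
  simp only [h.quad_mul_quad, smul_add, ← map_smul, Finset.sum_add_distrib, ← map_sum]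
  rw [quartic_congr W (U := T), h.quartic_eq_zero W hT, add_zero]
  · refine Finset.sum_congr rfl fun i hi => Finset.sum_congr rfl fun l hl => ?_
    congr 1
    simp only [Finset.sum_apply, Pi.smul_apply, smul_eq_mul, Finset.mul_sum]
    rw [Finset.sum_comm]
    exact Finset.sum_congr rfl fun j hj => hBC i hi j hj j hj l hl
  · simpa only [Finset.sum_apply, Pi.smul_apply, smul_eq_mul] using hBC

end IsCAR

end CAR

/-! ### The Kronig identity in a window of modes -/

/-- The modes of one flavour: spin, longitudinal and transverse coordinate. -/
abbrev Site (σ G : Type*) : Type _ := σ × ℤ × G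

/-- Weighted spin matrices `V i` whose tensor square `∑ w i Vᵢ ⊗ Vᵢ` is symmetric under exchange of
the column indices and whose square `∑ w i Vᵢ²` is the identity. -/
structure IsSpinResolution {σ κ : Type*} [Fintype σ] [DecidableEq σ] [Fintype κ] (w : κ → ℂ)
    (V : κ → Matrix σ σ ℂ) : Prop where
  symm : ∀ α δ β γ, ∑ i, w i * (V i α δ * V i β γ) = ∑ i, w i * (V i α γ * V i β δ)
  one : ∑ i, w i • (V i * V i) = 1

namespace IsSpinResolution

variable {σ κ : Type*} [Fintype σ] [DecidableEq σ] [Fintype κ] {w : κ → ℂ} {V : κ → Matrix σ σ ℂ}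

theorem sum_mul_apply (h : IsSpinResolution w V) (α γ : σ) :
    ∑ δ, ∑ i, w i * (V i α δ * V i δ γ) = if α = γ then 1 else 0 := by
  rw [← Matrix.one_apply, ← h.one, Finset.sum_comm]
  simp only [Matrix.sum_apply, Matrix.smul_apply, Matrix.mul_apply, Finset.mul_sum, smul_eq_mul]

theorem sum_trace_smul (h : IsSpinResolution w V) : ∑ i, (w i * (V i).trace) • V i = 1 := by
  ext α γ
  rw [Matrix.one_apply, ← h.sum_mul_apply]
  simp only [h.symm α _ _ γ, Matrix.sum_apply, Matrix.smul_apply, Matrix.trace, Matrix.diag_apply,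
    Finset.mul_sum, Finset.sum_mul, smul_eq_mul]
  rw [Finset.sum_comm]
  exact Finset.sum_congr rfl fun δ _ => Finset.sum_congr rfl fun i _ => by ring

theorem sum_trace_sq (h : IsSpinResolution w V) :
    ∑ i, w i * (V i).trace ^ 2 = Fintype.card σ := by
  rw [← Matrix.trace_one (n := σ) (R := ℂ), ← h.sum_trace_smul, Matrix.trace_sum]
  exact Finset.sum_congr rfl fun i _ => by rw [Matrix.trace_smul, smul_eq_mul, sq, mul_assoc]

end IsSpinResolution

/-- The representative of `±p` whose longitudinal coordinate is nonnegative; boson normal ordering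
puts the density with this momentum to the right. -/
def forward {G : Type*} [Neg G] (p : ℤ × G) : ℤ × G := if 0 < p.1 then p else -p

section Forward

variable {G : Type*} [AddCommGroup G]

theorem eq_forward_iff {d p : ℤ × G} : d = forward p ↔ p = d ∧ 0 < d.1 ∨ p = -d ∧ 0 ≤ d.1 := by
  unfold forward
  split_ifs with h
  · constructor
    · rintro rfl
      exact .inl ⟨rfl, h⟩
    · rintro (⟨rfl, -⟩ | ⟨rfl, h'⟩)
      · rfl
      · rw [Prod.fst_neg] at h
        lia
  · constructor
    · rintro rfl
      exact .inr ⟨(neg_neg p).symm, by rw [Prod.fst_neg]; lia⟩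
    · rintro (⟨rfl, h'⟩ | ⟨rfl, -⟩)
      · exact absurd h' h
      · exact (neg_neg d).symm

theorem forward_eq_zero {p : ℤ × G} : forward p = 0 ↔ p = 0 := by
  rw [eq_comm, eq_forward_iff, Prod.fst_zero, neg_zero]
  simp

theorem fst_forward (p : ℤ × G) : (forward p).1 = |p.1| := by
  unfold forward
  split_ifs with h
  · exact (abs_of_pos h).symm
  · rw [Prod.fst_neg, abs_of_nonpos (not_lt.1 h)]

end Forward

/-- The number of integers with absolute value `d`. -/
def absCount (d : ℤ) : ℂ := if 0 < d then 2 else if d = 0 then 1 else 0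

theorem absCount_add_neg (d : ℤ) : absCount d + absCount (-d) = 2 := by
  unfold absCount
  rcases lt_trichotomy d 0 with h | rfl | h
  · rw [if_neg (by lia), if_neg (by lia), if_pos (by lia), zero_add]
  · norm_num
  · rw [if_pos h, if_neg (by lia), if_neg (by lia), add_zero]

theorem sum_absCount_sub {N : ℕ} {m : ℤ} (h : -(N : ℤ) ≤ m) (h' : m < N) :
    ∑ l ∈ Finset.Ico (-N : ℤ) N, absCount (m - l) = 2 * (m + N) + 1 := by
  have hsplit (l : ℤ) :
      absCount (m - l) = 2 * (if l < m then 1 else 0) + if m = l then 1 else 0 := by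
    unfold absCount
    rcases lt_trichotomy l m with h | h | h
    · rw [if_pos (by lia), if_pos h, if_neg (by lia)]; norm_num
    · rw [if_neg (by lia), if_pos (by lia), if_neg (by lia), if_pos (by lia)]; norm_num
    · rw [if_neg (by lia), if_neg (by lia), if_neg (by lia), if_neg (by lia)]; norm_num
  have hfilter : (Finset.Ico (-N : ℤ) N).filter (· < m) = Finset.Ico (-N : ℤ) m := by
    ext l
    simp only [Finset.mem_filter, Finset.mem_Ico]
    lia
  simp only [hsplit, Finset.sum_add_distrib, ← Finset.mul_sum]
  rw [Finset.sum_boole, Finset.sum_ite_eq, if_pos (Finset.mem_Ico.2 ⟨h, h'⟩), hfilter,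
    ← Int.cast_natCast, Int.card_Ico_of_le _ _ h]
  push_cast
  ring

theorem sum_Ico_mul_negIndicator (N : ℕ) (f : ℤ → ℂ) :
    ∑ m ∈ Finset.Ico (-N : ℤ) N, f m * (if m < 0 then 1 else 0) =
      ∑ j ∈ Finset.range N, f (-j - 1) := by
  simp only [mul_ite, mul_one, mul_zero]
  rw [← Finset.sum_filter]
  symm
  refine Finset.sum_bij (fun j _ => -(j : ℤ) - 1) (fun j hj => ?_) (fun j _ j' _ h => by lia)
    (fun m hm => ?_) fun j _ => rfl
  · rw [Finset.mem_range] at hj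
    rw [Finset.mem_filter, Finset.mem_Ico]
    lia
  · rw [Finset.mem_filter, Finset.mem_Ico] at hm
    exact ⟨(-m - 1).toNat, by rw [Finset.mem_range]; lia, by lia⟩

namespace Site

variable {σ G : Type*}

section Hop

variable [AddCommGroup G] [DecidableEq G]

/-- The matrix on the modes which shifts the coordinates by `p` and acts by `V` on the spin. -/
def hop (p : ℤ × G) : Matrix σ σ ℂ →ₗ[ℂ] Site σ G → Site σ G → ℂ where
  toFun V x y := if y.2 = x.2 + p then V x.1 y.1 else 0
  map_add' V V' := by
    ext x y
    simp only [Matrix.add_apply, Pi.add_apply]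
    split_ifs <;> simp
  map_smul' z V := by
    ext x y
    simp

theorem hop_apply (p : ℤ × G) (V : Matrix σ σ ℂ) (x y : Site σ G) :
    hop p V x y = if y.2 = x.2 + p then V x.1 y.1 else 0 := rfl

theorem hop_zero_one [DecidableEq σ] (x y : Site σ G) :
    hop 0 (1 : Matrix σ σ ℂ) x y = if x = y then 1 else 0 := by
  rw [hop_apply, Matrix.one_apply, add_zero, ← ite_and]
  exact if_congr (by rw [Prod.ext_iff (x := x), and_comm, eq_comm (a := y.2)]) rfl rfl

theorem hop_neg_mul_hop (p : ℤ × G) (V : Matrix σ σ ℂ) (x y k l : Site σ G) :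
    hop (-p) V x y * hop p V k l =
      V x.1 y.1 * V k.1 l.1 * (if x.2 + k.2 = y.2 + l.2 then 1 else 0) *
        (if x.2 - y.2 = p then 1 else 0) := by
  have hxy : y.2 = x.2 + -p ↔ x.2 - y.2 = p := by grind
  rw [hop_apply, hop_apply, if_congr hxy rfl rfl]
  split_ifs <;> grind

end Hop

/-- Indicator of the Dirac sea. -/
def sea (x : Site σ G) : ℂ := if x.2.1 < 0 then 1 else 0

section Window

variable [Fintype σ] [Fintype G]

/-- The modes with longitudinal coordinate in `[-N, N)`. -/
noncomputable def window (σ G : Type*) [Fintype σ] [Fintype G] (N : ℕ) : Finset (Site σ G) :=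
  Finset.univ ×ˢ Finset.Ico (-N : ℤ) N ×ˢ Finset.univ

/-- The momenta with longitudinal coordinate in `(-Q, Q)`. -/
noncomputable def momenta (G : Type*) [Fintype G] (Q : ℕ) : Finset (ℤ × G) :=
  Finset.Ioo (-Q : ℤ) Q ×ˢ Finset.univ

theorem mem_window {N : ℕ} {x : Site σ G} :
    x ∈ window σ G N ↔ -(N : ℤ) ≤ x.2.1 ∧ x.2.1 < N := by
  simp [window]

theorem sum_window (N : ℕ) {B : Type*} [AddCommMonoid B] (f : Site σ G → B) :
    ∑ x ∈ window σ G N, f x = ∑ α, ∑ m ∈ Finset.Ico (-N : ℤ) N, ∑ t, f (α, m, t) := by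
  simp only [window, Finset.sum_product]

theorem sum_window_longitudinal (N : ℕ) (U : σ → ℂ) (f : ℤ → ℂ) :
    ∑ x ∈ window σ G N, U x.1 * f x.2.1 =
      (∑ α, U α) * (Fintype.card G * ∑ m ∈ Finset.Ico (-N : ℤ) N, f m) := by
  rw [sum_window, Finset.sum_mul]
  refine Finset.sum_congr rfl fun α _ => ?_
  simp only [Finset.sum_const, Finset.card_univ, nsmul_eq_mul, Finset.mul_sum, mul_left_comm]

theorem sum_momenta_forward [AddCommGroup G] [DecidableEq G] {d : ℤ × G} {Q : ℕ}
    (hd : |d.1| < Q) :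
    ∑ p ∈ momenta G Q, (if d = forward p then (1 : ℂ) else 0) = absCount d.1 := by
  rw [abs_lt] at hd
  have hmem {p : ℤ × G} (hp : p = d ∨ p = -d) : p ∈ momenta G Q := by
    rcases hp with rfl | rfl <;>
      simp only [momenta, Finset.mem_product, Finset.mem_Ioo, Finset.mem_univ, Prod.fst_neg,
        and_true] <;> lia
  rw [Finset.sum_boole, absCount]
  split_ifs with hpos hzero
  · have hne : d ≠ -d := fun h => by
      have := congrArg Prod.fst h
      rw [Prod.fst_neg] at this
      lia
    have hset : (momenta G Q).filter (fun p => d = forward p) = {d, -d} := by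
      ext p
      rw [Finset.mem_filter, eq_forward_iff, Finset.mem_insert, Finset.mem_singleton]
      exact ⟨fun h => h.2.imp And.left And.left,
        fun h => ⟨hmem h, h.imp (⟨·, hpos⟩) (⟨·, hpos.le⟩)⟩⟩
    rw [hset, Finset.card_pair hne, Nat.cast_two]
  · have hset : (momenta G Q).filter (fun p => d = forward p) = {-d} := by
      ext p
      rw [Finset.mem_filter, eq_forward_iff, Finset.mem_singleton]
      exact ⟨fun h => by tauto, fun h => ⟨hmem (.inr h), .inr ⟨h, hzero.ge⟩⟩⟩
    rw [hset, Finset.card_singleton, Nat.cast_one]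
  · have hset : (momenta G Q).filter (fun p => d = forward p) = ∅ :=
      Finset.filter_eq_empty_iff.2 fun p _ hp => by
        rw [eq_forward_iff] at hp
        lia
    rw [hset, Finset.card_empty, Nat.cast_zero]

theorem sum_energy_sea (N : ℕ) :
    ∑ x ∈ window σ G N, ((x.2.1 : ℂ) + 1 / 2) * sea x =
      -(Fintype.card σ * Fintype.card G * N ^ 2 / 2) := by
  have hodd : ∑ j ∈ Finset.range N, (((-(j : ℤ) - 1 : ℤ) : ℂ) + 1 / 2) = -(N : ℂ) ^ 2 / 2 := by
    induction N with
    | zero => simp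
    | succ n ih =>
      rw [Finset.sum_range_succ, ih]
      push_cast
      ring
  have h := sum_window_longitudinal (G := G) N (fun _ : σ => 1)
    fun m => ((m : ℂ) + 1 / 2) * if m < 0 then 1 else 0
  simp only [one_mul, Finset.sum_const, Finset.card_univ, nsmul_eq_mul, mul_one] at h
  rw [sum_Ico_mul_negIndicator N fun m => (m : ℂ) + 1 / 2, hodd] at h
  exact h.trans (by ring)

theorem sum_hop_diag_sea [AddCommGroup G] [DecidableEq G] (p : ℤ × G) (V : Matrix σ σ ℂ) (N : ℕ) :
    ∑ x ∈ window σ G N, hop p V x x * sea x =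
      if p = 0 then V.trace * (Fintype.card G * N) else 0 := by
  simp only [hop_apply, left_eq_add]
  split_ifs
  · have h := sum_window_longitudinal (G := G) N V.diag fun m => 1 * if m < 0 then 1 else 0
    rw [sum_Ico_mul_negIndicator N fun _ => 1] at h
    simp only [one_mul, Finset.sum_const, Finset.card_range, nsmul_eq_mul, mul_one] at h
    exact h
  · simp

end Window

section NormalOrdering

variable [Fintype σ] [DecidableEq σ] [Fintype G] [DecidableEq G] {A : Type*} [Ring A] [Algebra ℂ A]

/-- The normal ordered bilinear of the modes `x` and `y`. -/
def normalBilin (c c' : Site σ G → A) (x y : Site σ G) : A :=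
  c' x * c y - (if x = y then sea x else 0) • (1 : A)

/-- The normal ordered bilinear with coefficients `B` in a window. -/
noncomputable def normalQuad (N : ℕ) (c c' : Site σ G → A) : (Site σ G → Site σ G → ℂ) →ₗ[ℂ] A where
  toFun B := ∑ x ∈ window σ G N, ∑ y ∈ window σ G N, B x y • normalBilin c c' x y
  map_add' B C := by simp only [Pi.add_apply, add_smul, Finset.sum_add_distrib]
  map_smul' z B := by
    simp only [Pi.smul_apply, smul_eq_mul, mul_smul, Finset.smul_sum, RingHom.id_apply]

theorem normalQuad_apply (N : ℕ) (c c' : Site σ G → A) (B : Site σ G → Site σ G → ℂ) :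
    normalQuad N c c' B =
      ∑ x ∈ window σ G N, ∑ y ∈ window σ G N, B x y • normalBilin c c' x y := rfl

theorem normalQuad_eq (N : ℕ) (c c' : Site σ G → A) (B : Site σ G → Site σ G → ℂ) :
    normalQuad N c c' B =
      quad (window σ G N) c c' B - (∑ x ∈ window σ G N, B x x * sea x) • (1 : A) := by
  rw [normalQuad_apply, quad_apply, Finset.sum_smul, ← Finset.sum_sub_distrib]
  refine Finset.sum_congr rfl fun x hx => ?_
  simp only [normalBilin, smul_sub, Finset.sum_sub_distrib, smul_smul, ite_smul, zero_smul,
    smul_ite, smul_zero]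
  rw [Finset.sum_ite_eq, if_pos hx]

end NormalOrdering

section Kronig

variable [AddCommGroup G] [DecidableEq G] {A κ : Type*} [Fintype κ] {w : κ → ℂ}
  {V : κ → Matrix σ σ ℂ}

/-- The quartic coefficients of the sum over all momenta of the products of two densities. -/
def kronigKernel (w : κ → ℂ) (V : κ → Matrix σ σ ℂ) (x y k l : Site σ G) : ℂ :=
  (∑ i, w i * (V i x.1 y.1 * V i k.1 l.1)) * (if x.2 + k.2 = y.2 + l.2 then 1 else 0) *
    absCount (x.2.1 - y.2.1)

theorem sum_hop_mul_hop [Fintype G] (w : κ → ℂ) (V : κ → Matrix σ σ ℂ) {x y : Site σ G}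
    (k l : Site σ G) {Q : ℕ} (hQ : |x.2.1 - y.2.1| < Q) :
    ∑ i, ∑ p ∈ momenta G Q, w i * (hop (-forward p) (V i) x y * hop (forward p) (V i) k l) =
      kronigKernel w V x y k l := by
  rw [kronigKernel, ← Prod.fst_sub, ← sum_momenta_forward (by exact hQ), Finset.sum_mul,
    Finset.sum_mul]
  refine Finset.sum_congr rfl fun i _ => ?_
  simp only [hop_neg_mul_hop, Finset.mul_sum, mul_assoc]

theorem kronigKernel_add_flip (w : κ → ℂ) (V : κ → Matrix σ σ ℂ) (x y k l : Site σ G) :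
    kronigKernel w V x y k l + kronigKernel w V k l x y =
      (∑ i, w i * (V i x.1 y.1 * V i k.1 l.1)) * if x.2 + k.2 = y.2 + l.2 then 2 else 0 := by
  have hspin : ∑ i, w i * (V i k.1 l.1 * V i x.1 y.1) = ∑ i, w i * (V i x.1 y.1 * V i k.1 l.1) :=
    Finset.sum_congr rfl fun i _ => by rw [mul_comm (V i k.1 l.1)]
  rw [kronigKernel, kronigKernel, hspin, add_comm k.2, add_comm l.2]
  split_ifs with h
  · have hneg : k.2.1 - l.2.1 = -(x.2.1 - y.2.1) := by
      have := congrArg Prod.fst h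
      simp only [Prod.fst_add] at this
      lia
    rw [hneg, mul_one, ← mul_add, absCount_add_neg]
  · ring

variable [Fintype σ] [DecidableEq σ]

theorem kronigKernel_symm (hV : IsSpinResolution w V) (x y k l : Site σ G) :
    kronigKernel w V x y k l + kronigKernel w V k l x y =
      kronigKernel w V x l k y + kronigKernel w V k y x l := by
  rw [kronigKernel_add_flip, kronigKernel_add_flip, hV.symm, add_comm l.2]

variable [Fintype G]

theorem sum_kronigKernel (hV : IsSpinResolution w V) {N : ℕ} {x : Site σ G}
    (hx : x ∈ window σ G N) (l : Site σ G) :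
    ∑ y ∈ window σ G N, kronigKernel w V x y y l =
      if x = l then (Fintype.card G : ℂ) * (2 * (x.2.1 + N) + 1) else 0 := by
  rw [mem_window] at hx
  have hcons (y : Site σ G) : x.2 + y.2 = y.2 + l.2 ↔ x.2 = l.2 := by
    rw [add_comm, add_left_cancel_iff]
  simp only [kronigKernel, hcons, mul_right_comm _ (ite _ _ _), ← Finset.sum_mul]
  rw [sum_window_longitudinal N (fun α => ∑ i, w i * (V i x.1 α * V i α l.1))
    fun m => absCount (x.2.1 - m), sum_absCount_sub hx.1 hx.2, hV.sum_mul_apply,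
    if_congr (Prod.ext_iff (x := x) (y := l)) rfl rfl, ite_and]
  split_ifs <;> simp

variable [Ring A] [Algebra ℂ A]

theorem sum_quad_hop {c c' : Site σ G → A} (hc : IsCAR c c') (hV : IsSpinResolution w V)
    {N Q : ℕ} (hQ : 2 * N ≤ Q) :
    ∑ i, w i • ∑ p ∈ momenta G Q, quad (window σ G N) c c' (hop (-forward p) (V i)) *
        quad (window σ G N) c c' (hop (forward p) (V i)) =
      ∑ x ∈ window σ G N, ((Fintype.card G : ℂ) * (2 * (x.2.1 + N) + 1)) • (c' x * c x) := by
  simp only [Finset.smul_sum, ← Finset.sum_product']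
  rw [hc.sum_quad_mul_quad (window σ G N) (v := fun p : κ × ℤ × G => w p.1)
    (B := fun p => hop (-forward p.2) (V p.1)) (C := fun p => hop (forward p.2) (V p.1))
    (T := kronigKernel w V)]
  · exact quad_eq_sum_of_diag _ fun x hx l _ => sum_kronigKernel hV hx l
  · intro x hx y hy k _ l _
    rw [mem_window] at hx hy
    rw [Finset.sum_product, sum_hop_mul_hop w V k l (abs_lt.2 ⟨by lia, by lia⟩)]
  · exact fun x _ y _ k _ l _ => kronigKernel_symm hV x y k l

theorem sum_normalQuad_mul_normalQuad (c c' : Site σ G → A) (U : Matrix σ σ ℂ) (N : ℕ) {Q : ℕ}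
    (hQ : 0 < Q) :
    ∑ p ∈ momenta G Q, normalQuad N c c' (hop (-forward p) U) *
        normalQuad N c c' (hop (forward p) U) =
      ∑ p ∈ momenta G Q, quad (window σ G N) c c' (hop (-forward p) U) *
        quad (window σ G N) c c' (hop (forward p) U) +
      (-2 * (U.trace * (Fintype.card G * N))) • quad (window σ G N) c c' (hop 0 U) +
      (U.trace * (Fintype.card G * N)) ^ 2 • 1 := by
  have hzero : (0 : ℤ × G) ∈ momenta G Q := by simp [momenta, hQ]
  rw [add_assoc, ← sub_eq_iff_eq_add', ← Finset.sum_sub_distrib,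
    Finset.sum_eq_single_of_mem 0 hzero]
  · simp only [normalQuad_eq, sum_hop_diag_sea, forward_eq_zero.2, neg_zero, if_true, sub_mul,
      mul_sub, smul_mul_assoc, mul_smul_comm, one_mul, mul_one]
    module
  · intro p _ hp
    have hp' := mt forward_eq_zero.1 hp
    rw [normalQuad_eq, normalQuad_eq, sum_hop_diag_sea, sum_hop_diag_sea, if_neg hp',
      if_neg (neg_ne_zero.2 hp'), zero_smul, sub_zero, sub_zero, sub_self]

/-- The Kronig identity for the modes in a window. -/
theorem sum_normalQuad_hop {c c' : Site σ G → A} (hc : IsCAR c c') (hV : IsSpinResolution w V)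
    {N Q : ℕ} (hQ : 2 * N ≤ Q) (hQ0 : 0 < Q) :
    ∑ i, w i • ∑ p ∈ momenta G Q, normalQuad N c c' (hop (-forward p) (V i)) *
        normalQuad N c c' (hop (forward p) (V i)) =
      (2 * Fintype.card G : ℂ) •
        ∑ x ∈ window σ G N, ((x.2.1 : ℂ) + 1 / 2) • normalBilin c c' x x := by
  have hlin : ∑ i, w i • ((-2 * ((V i).trace * (Fintype.card G * N))) •
        quad (window σ G N) c c' (hop 0 (V i))) =
      (-2 * (Fintype.card G * N) : ℂ) • ∑ x ∈ window σ G N, c' x * c x := by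
    have hone : quad (window σ G N) c c' (hop 0 1) = ∑ x ∈ window σ G N, c' x * c x := by
      rw [quad_eq_sum_of_diag _ fun x _ y _ => hop_zero_one x y]
      simp only [one_smul]
    rw [← hone, ← hV.sum_trace_smul, map_sum, map_sum, Finset.smul_sum]
    refine Finset.sum_congr rfl fun i _ => ?_
    rw [map_smul, map_smul]
    module
  have hconst : ∑ i, w i • (((V i).trace * (Fintype.card G * N)) ^ 2 • (1 : A)) =
      (Fintype.card σ * (Fintype.card G * N) ^ 2 : ℂ) • (1 : A) := by
    simp only [smul_smul]
    rw [← Finset.sum_smul, ← hV.sum_trace_sq, Finset.sum_mul]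
    congr 1
    exact Finset.sum_congr rfl fun i _ => by ring
  have hright : ∑ x ∈ window σ G N, ((x.2.1 : ℂ) + 1 / 2) • normalBilin c c' x x =
      ∑ x ∈ window σ G N, ((x.2.1 : ℂ) + 1 / 2) • (c' x * c x) +
        ((Fintype.card σ * Fintype.card G * N ^ 2 / 2 : ℂ)) • (1 : A) := by
    simp only [normalBilin, smul_sub, Finset.sum_sub_distrib, smul_smul, if_true]
    rw [← Finset.sum_smul, sum_energy_sea, neg_smul, sub_neg_eq_add]
  simp only [sum_normalQuad_mul_normalQuad c c' _ N hQ0, Finset.sum_add_distrib, smul_add,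
    sum_quad_hop hc hV hQ, hlin, hconst, hright]
  rw [Finset.smul_sum, Finset.smul_sum, ← Finset.sum_add_distrib]
  congr 1
  · exact Finset.sum_congr rfl fun x _ => by module
  · module

end Kronig

end Site

/-! ### Confined vectors -/

namespace Site

section Confined

variable {σ G F : Type*} [NormedAddCommGroup F] [NormedSpace ℂ F]

/-- The vectors which look like the Dirac vacuum outside the window `[-N, N)`. -/
def confined (c c' : Site σ G → F →L[ℂ] F) (N : ℕ) : Submodule ℂ F where
  carrier := {η | ∀ x, ((N : ℤ) ≤ x.2.1 → c x η = 0) ∧ (x.2.1 < -(N : ℤ) → c' x η = 0)}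
  add_mem' h h' x := ⟨fun hx => by rw [map_add, (h x).1 hx, (h' x).1 hx, add_zero],
    fun hx => by rw [map_add, (h x).2 hx, (h' x).2 hx, add_zero]⟩
  zero_mem' _ := ⟨fun _ => map_zero _, fun _ => map_zero _⟩
  smul_mem' z _ h x := ⟨fun hx => by rw [map_smul, (h x).1 hx, smul_zero],
    fun hx => by rw [map_smul, (h x).2 hx, smul_zero]⟩

variable {c c' : Site σ G → F →L[ℂ] F} {N N' : ℕ} {η : F}

theorem confined_mono (hN : N ≤ N') : confined c c' N ≤ confined c c' N' := fun _ h x =>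
  ⟨fun hx => (h x).1 (by lia), fun hx => (h x).2 (by lia)⟩

variable [DecidableEq σ] [DecidableEq G]

theorem normalBilin_eq_zero (hc : IsCAR c c') (h : η ∈ confined c c' N) {x y : Site σ G}
    (hxy : x.2.1 < -(N : ℤ) ∨ (N : ℤ) ≤ y.2.1) : normalBilin c c' x y η = 0 := by
  rcases hxy with hx | hy
  · have hswap : normalBilin c c' x y = -(c y * c' x) := by
      have hsea : sea x = 1 := if_pos (by lia)
      rw [normalBilin, hc.cre_mul_ann, hsea, ite_smul, one_smul, zero_smul, sub_sub_cancel_left]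
    rw [hswap, neg_apply, mul_apply_eq_comp, (h x).2 hx, map_zero, neg_zero]
  · have hsea : (if x = y then sea x else 0) = 0 := by
      split_ifs with heq
      · rw [sea, if_neg (by rw [heq]; lia)]
      · rfl
    rw [normalBilin, hsea, zero_smul, sub_zero, mul_apply_eq_comp, (h y).1 hy, map_zero]

theorem ann_mem_confined (hc : IsCAR c c') (h : η ∈ confined c c' N) {y : Site σ G}
    (hy : -(N : ℤ) ≤ y.2.1) : c y η ∈ confined c c' N := by
  refine fun x => ⟨fun hx => ?_, fun hx => ?_⟩
  · rw [← mul_apply_eq_comp, hc.ann_mul_ann, neg_apply, mul_apply_eq_comp,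
      (h x).1 hx, map_zero, neg_zero]
  · rw [← mul_apply_eq_comp, hc.cre_mul_ann, if_neg (by rintro rfl; lia), zero_sub, neg_apply,
      mul_apply_eq_comp, (h x).2 hx, map_zero, neg_zero]

theorem cre_mem_confined (hc : IsCAR c c') (h : η ∈ confined c c' N) {y : Site σ G}
    (hy : y.2.1 < N) : c' y η ∈ confined c c' N := by
  refine fun x => ⟨fun hx => ?_, fun hx => ?_⟩
  · rw [← mul_apply_eq_comp, hc.ann_mul_cre, if_neg (by rintro rfl; lia), zero_sub, neg_apply,
      mul_apply_eq_comp, (h x).1 hx, map_zero, neg_zero]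
  · rw [← mul_apply_eq_comp, hc.cre_mul_cre, neg_apply, mul_apply_eq_comp,
      (h x).2 hx, map_zero, neg_zero]

variable [Fintype σ] [Fintype G]

theorem normalQuad_mem_confined (hc : IsCAR c c') (h : η ∈ confined c c' N)
    (B : Site σ G → Site σ G → ℂ) : normalQuad N c c' B η ∈ confined c c' N := by
  simp only [normalQuad_apply, sum_apply, smul_apply]
  refine sum_mem fun x hx => sum_mem fun y hy => Submodule.smul_mem _ _ ?_
  rw [mem_window] at hx hy
  exact sub_mem (cre_mem_confined hc (ann_mem_confined hc h hy.1) hx.2) (Submodule.smul_mem _ _ h)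

theorem hasSum_normalBilin_self (hc : IsCAR c c') (h : η ∈ confined c c' N) (hN : N ≤ N')
    (f : Site σ G → ℂ) :
    HasSum (fun x => f x • normalBilin c c' x x η)
      (∑ x ∈ window σ G N', f x • normalBilin c c' x x η) := by
  refine hasSum_sum_of_ne_finset_zero fun x hx => ?_
  rw [mem_window] at hx
  rw [normalBilin_eq_zero hc h (by lia), smul_zero]

variable [AddCommGroup G]

theorem normalQuad_hop_eq_zero (hc : IsCAR c c') (h : η ∈ confined c c' N) (U : Matrix σ σ ℂ)
    {p : ℤ × G} (hp : 2 * (N : ℤ) ≤ p.1) : normalQuad N' c c' (hop p U) η = 0 := by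
  simp only [normalQuad_apply, sum_apply, smul_apply, hop_apply]
  refine Finset.sum_eq_zero fun x _ => Finset.sum_eq_zero fun y _ => ?_
  split_ifs with hxy
  · have := congrArg Prod.fst hxy
    rw [Prod.fst_add] at this
    rw [normalBilin_eq_zero hc h (by lia), smul_zero]
  · exact zero_smul ℂ _

theorem hasSum_normalBilin_hop (hc : IsCAR c c') (h : η ∈ confined c c' N) (U : Matrix σ σ ℂ)
    {p : ℤ × G} (hN : N + |p.1| ≤ (N' : ℤ)) :
    HasSum (fun i : Site σ G × Site σ G => hop p U i.1 i.2 • normalBilin c c' i.1 i.2 η)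
      (normalQuad N' c c' (hop p U) η) := by
  have hsum : normalQuad N' c c' (hop p U) η = ∑ i ∈ window σ G N' ×ˢ window σ G N',
      hop p U i.1 i.2 • normalBilin c c' i.1 i.2 η := by
    simp only [normalQuad_apply, sum_apply, smul_apply, Finset.sum_product]
  rw [hsum]
  refine hasSum_sum_of_ne_finset_zero fun i hi => ?_
  rw [hop_apply]
  split_ifs with hxy
  · have hfst := congrArg Prod.fst hxy
    have hneg := neg_abs_le p.1
    have hle := le_abs_self p.1
    rw [Prod.fst_add] at hfst
    rw [Finset.mem_product, mem_window, mem_window] at hi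
    rw [normalBilin_eq_zero hc h (by lia), smul_zero]
  · exact zero_smul ℂ _

end Confined

end Site

theorem hasSum_ite_eq_snd {ι κ F : Type*} [AddCommMonoid F] [TopologicalSpace F] [DecidableEq κ]
    {g : ι → F} {a : F} (h : HasSum g a) (n : ι → κ) :
    HasSum (fun i : ι × κ => if i.2 = n i.1 then g i.1 else 0) a := by
  have hinj : Function.Injective fun i => (i, n i) := fun i j hij => congrArg Prod.fst hij
  refine (hinj.hasSum_iff fun i hi => if_neg fun hn => hi ⟨i.1, ?_⟩).1 ?_
  · exact Prod.ext rfl hn.symm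
  · simpa [Function.comp_def] using h

theorem rep_add_eq_iff {M : ℕ} [NeZero M] {rep : ZMod M → ℤ} (hrep : ∀ z, (rep z : ZMod M) = z)
    (x y : ZMod M) (t m : ℤ) :
    rep x + t = rep y + m * M ↔ y = x + t ∧ m = (rep x + t - rep y) / M := by
  have hM : (M : ℤ) ≠ 0 := by exact_mod_cast NeZero.ne M
  have hy : y = x + t ↔ (M : ℤ) ∣ rep x + t - rep y := by
    rw [← ZMod.intCast_zmod_eq_zero_iff_dvd]
    push_cast
    rw [hrep, hrep, sub_eq_zero, eq_comm]
  rw [hy]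
  constructor
  · intro h
    have hm : rep x + t - rep y = m * M := by lia
    rw [hm]
    exact ⟨Dvd.intro_left m rfl, (Int.mul_ediv_cancel m hM).symm⟩
  · rintro ⟨hdvd, rfl⟩
    rw [Int.ediv_mul_cancel hdvd]
    ring

/-! ### Integer coordinates of the nodal momenta -/

namespace Nodal

theorem sgn_mul_self (r : ℤˣ) : sgn r * sgn r = 1 := by
  rcases Int.units_eq_one_or r with rfl | rfl <;> simp [sgn]

theorem sgn_ne_zero (r : ℤˣ) : sgn r ≠ 0 := left_ne_zero_of_mul_eq_one (sgn_mul_self r)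

theorem units_neg_ne (s : ℤˣ) : -s ≠ s := by
  revert s
  decide

theorem units_eq_or_eq_neg (u s : ℤˣ) : u = s ∨ u = -s := by
  revert u s
  decide

theorem momentum_ext_iff {p p' : Momentum} (s : ℤˣ) :
    p = p' ↔ p s = p' s ∧ p (-s) = p' (-s) := by
  refine ⟨by rintro rfl; exact ⟨rfl, rfl⟩, fun h => funext fun u => ?_⟩
  rcases units_eq_or_eq_neg u s with rfl | rfl
  exacts [h.1, h.2]

/-- The momentum `k` with `r kₛ = (2π/L)(l + o)` and `k₋ₛ = (2π/L)(t + o)`. -/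
noncomputable def latticePoint (L : ℝ) (r s : ℤˣ) (o : ℝ) (l t : ℤ) : Momentum := fun u =>
  if u = s then sgn r * (2 * Real.pi / L * (l + o)) else 2 * Real.pi / L * (t + o)

section LatticePoint

variable {L : ℝ} {r s : ℤˣ} {o : ℝ}

theorem latticePoint_self (l t : ℤ) :
    latticePoint L r s o l t s = sgn r * (2 * Real.pi / L * (l + o)) := if_pos rfl

theorem latticePoint_neg (l t : ℤ) :
    latticePoint L r s o l t (-s) = 2 * Real.pi / L * (t + o) := if_neg (units_neg_ne s)

theorem latticePoint_inj (hL : L ≠ 0) {l t l' t' : ℤ} :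
    latticePoint L r s o l t = latticePoint L r s o l' t' ↔ l = l' ∧ t = t' := by
  have hunit : 2 * Real.pi / L ≠ 0 := div_ne_zero Real.two_pi_pos.ne' hL
  rw [momentum_ext_iff s, latticePoint_self, latticePoint_self, latticePoint_neg, latticePoint_neg,
    mul_right_inj' (sgn_ne_zero r), mul_right_inj' hunit, mul_right_inj' hunit, add_left_inj,
    add_left_inj, Int.cast_inj, Int.cast_inj]

theorem latticePoint_add (l t q u : ℤ) :
    latticePoint L r s o l t + latticePoint L r s 0 q u =
      latticePoint L r s o (l + q) (t + u) := by
  rw [momentum_ext_iff s]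
  simp only [Pi.add_apply, latticePoint_self, latticePoint_neg]
  push_cast
  constructor <;> ring

theorem neg_latticePoint (q t : ℤ) :
    -latticePoint L r s 0 q t = latticePoint L r s 0 (-q) (-t) := by
  rw [momentum_ext_iff s]
  simp only [Pi.neg_apply, latticePoint_self, latticePoint_neg]
  push_cast
  constructor <;> ring

theorem sgn_mul_latticePoint_neg_iff (hL : 0 < L) (q t : ℤ) :
    sgn r * latticePoint L r s 0 q t s < 0 ↔ q < 0 := by
  have hunit : 0 < 2 * Real.pi / L := by positivity
  rw [latticePoint_self, ← mul_assoc, sgn_mul_self, one_mul, add_zero, ← neg_pos, ← mul_neg,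
    mul_pos_iff_of_pos_left hunit, neg_pos, Int.cast_lt_zero]

end LatticePoint

section Representative

variable {M : ℕ} [NeZero M]

/-- The representative in `[b, b + M)` of a residue class modulo `M`. -/
def representative (b : ℤ) (z : ZMod M) : ℤ := b + (z - b).val

theorem cast_representative (b : ℤ) (z : ZMod M) : (representative b z : ZMod M) = z := by
  rw [representative, Int.cast_add, Int.cast_natCast, ZMod.natCast_zmod_val, add_sub_cancel]

theorem representative_mem (b : ℤ) (z : ZMod M) :
    b ≤ representative b z ∧ representative b z < b + M := by
  have := ZMod.val_lt (z - (b : ZMod M))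
  rw [representative]
  lia

theorem representative_intCast {b t : ℤ} (h : b ≤ t ∧ t < b + M) :
    representative b (t : ZMod M) = t := by
  rw [representative, ← Int.cast_sub, ZMod.val_intCast, Int.emod_eq_of_lt (by lia) (by lia),
    add_sub_cancel]

end Representative

/-- Momenta on the lattice shifted by `o`, with transverse component in `[-π/ã, π/ã)`: the fermion
momenta for `o = 1/2` and the boson momenta for `o = 0`. -/
def latticeMomenta (L a : ℝ) (s : ℤˣ) (o : ℝ) : Set Momentum :=
  {k | (∀ t, ∃ m : ℤ, k t = 2 * Real.pi / L * (m + o)) ∧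
    -(Real.pi / a) ≤ k (-s) ∧ k (-s) < Real.pi / a}

theorem bosonMomenta_eq (L a : ℝ) (s : ℤˣ) : bosonMomenta L a s = latticeMomenta L a s 0 := by
  simp only [bosonMomenta, latticeMomenta, add_zero]

/-- The integer transverse coordinate, in the Brillouin zone, of the class `z` modulo `M = L/ã`. -/
noncomputable def transverse {M : ℕ} (o : ℝ) (z : ZMod M) : ℤ := representative ⌈-(M / 2 : ℝ) - o⌉ z

variable {L a : ℝ} {M : ℕ} [NeZero M]

theorem cast_transverse (o : ℝ) (z : ZMod M) : (transverse o z : ZMod M) = z :=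
  cast_representative _ z

theorem pi_div_eq (hM : L = M * a) : Real.pi / a = 2 * Real.pi / L * (M / 2) := by
  have hM0 : (M : ℝ) ≠ 0 := NeZero.ne _
  rw [hM]
  field_simp

theorem transverse_mem_iff (hL : 0 < L) (hM : L = M * a) (o : ℝ) (t : ℤ) :
    (-(Real.pi / a) ≤ 2 * Real.pi / L * (t + o) ∧ 2 * Real.pi / L * (t + o) < Real.pi / a) ↔
      ⌈-(M / 2 : ℝ) - o⌉ ≤ t ∧ t < ⌈-(M / 2 : ℝ) - o⌉ + M := by
  have hunit : 0 < 2 * Real.pi / L := by positivity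
  rw [pi_div_eq hM, ← mul_neg, mul_le_mul_iff_right₀ hunit, mul_lt_mul_iff_right₀ hunit,
    Int.ceil_le, sub_le_iff_le_add, ← sub_lt_iff_lt_add, Int.lt_ceil, Int.cast_sub,
    Int.cast_natCast]
  exact and_congr_right fun _ => ⟨fun h => by linarith, fun h => by linarith⟩

theorem exists_eq_sgn_mul (r : ℤˣ) {o : ℝ} (ho : ∃ j : ℤ, 2 * o = j) (m : ℤ) :
    ∃ l : ℤ, (m : ℝ) + o = sgn r * (l + o) := by
  rcases Int.units_eq_one_or r with rfl | rfl
  · exact ⟨m, by simp [sgn]⟩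
  · obtain ⟨j, hj⟩ := ho
    refine ⟨-m - j, ?_⟩
    push_cast [sgn, ← hj]
    ring

theorem latticePoint_mem_latticeMomenta (hL : 0 < L) (hM : L = M * a) (r s : ℤˣ) {o : ℝ}
    (ho : ∃ j : ℤ, 2 * o = j) (l : ℤ) (z : ZMod M) :
    latticePoint L r s o l (transverse o z) ∈ latticeMomenta L a s o := by
  refine ⟨fun u => ?_, ?_⟩
  · obtain ⟨m, hm⟩ := exists_eq_sgn_mul r ho l
    rw [latticePoint]
    split_ifs
    · exact ⟨m, by rw [hm, mul_left_comm, ← mul_assoc (sgn r), sgn_mul_self, one_mul]⟩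
    · exact ⟨_, rfl⟩
  · rw [latticePoint_neg]
    exact (transverse_mem_iff hL hM o _).2 (representative_mem _ z)

theorem exists_latticePoint_eq (hL : 0 < L) (hM : L = M * a) (r s : ℤˣ) {o : ℝ}
    (ho : ∃ j : ℤ, 2 * o = j) {k : Momentum} (hk : k ∈ latticeMomenta L a s o) :
    ∃ (l : ℤ) (z : ZMod M), latticePoint L r s o l (transverse o z) = k := by
  obtain ⟨hlattice, htransverse⟩ := hk
  obtain ⟨m, hm⟩ := hlattice s
  obtain ⟨t, ht⟩ := hlattice (-s)
  obtain ⟨l, hl⟩ := exists_eq_sgn_mul r ho m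
  rw [ht, transverse_mem_iff hL hM] at htransverse
  refine ⟨l, t, (momentum_ext_iff s).2 ⟨?_, ?_⟩⟩
  · rw [latticePoint_self, hm, hl, mul_left_comm]
  · rw [latticePoint_neg, ht, transverse, representative_intCast htransverse]

/-- The coordinates `(l, z)` on the momenta in which `r kₛ = (2π/L)(l + o)`, while `z` is the
transverse coordinate, an element of `ℤ/M` because it matters only up to umklapp. -/
noncomputable def chart (hL : 0 < L) (hM : L = M * a) (r s : ℤˣ) {o : ℝ}
    (ho : ∃ j : ℤ, 2 * o = j) : ℤ × ZMod M ≃ latticeMomenta L a s o :=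
  Equiv.ofBijective
    (fun i => ⟨latticePoint L r s o i.1 (transverse o i.2),
      latticePoint_mem_latticeMomenta hL hM r s ho i.1 i.2⟩)
    ⟨fun i j h => by
      obtain ⟨hl, ht⟩ := (latticePoint_inj hL.ne').1 (Subtype.ext_iff.1 h)
      rw [Prod.ext_iff, ← cast_transverse o i.2, ht, cast_transverse]
      exact ⟨hl, rfl⟩,
    fun k => by
      obtain ⟨l, z, h⟩ := exists_latticePoint_eq hL hM r s ho k.2
      exact ⟨(l, z), Subtype.ext h⟩⟩

/-- The fermion momenta in the coordinates of `chart`. -/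
noncomputable def fermiChart (hL : 0 < L) (hM : L = M * a) (r s : ℤˣ) :
    ℤ × ZMod M ≃ fermiMomenta L a s := chart hL hM r s (o := 1 / 2) ⟨1, by norm_num⟩

theorem coe_fermiChart (hL : 0 < L) (hM : L = M * a) (r s : ℤˣ) (i : ℤ × ZMod M) :
    (fermiChart hL hM r s i).1 = latticePoint L r s (1 / 2) i.1 (transverse (1 / 2) i.2) := rfl

/-- The boson momenta in the coordinates of `chart`. -/
noncomputable def bosonChart (hL : 0 < L) (hM : L = M * a) (r s : ℤˣ) :
    ℤ × ZMod M ≃ bosonMomenta L a s :=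
  (chart hL hM r s ⟨0, by norm_num⟩).trans (Equiv.setCongr (bosonMomenta_eq L a s).symm)

theorem coe_bosonChart (hL : 0 < L) (hM : L = M * a) (r s : ℤˣ) (i : ℤ × ZMod M) :
    (bosonChart hL hM r s i).1 = latticePoint L r s 0 i.1 (transverse 0 i.2) := rfl

/-- The momentum selection rule of the nodal bilinears in integer coordinates. -/
theorem latticePoint_add_eq_iff (hL : 0 < L) (hM : L = M * a) {r s : ℤˣ} {o : ℝ}
    {l t l' t' q u n : ℤ} :
    latticePoint L r s o l t + latticePoint L r s 0 q u =
        latticePoint L r s o l' t' + Pi.single (-s) (2 * Real.pi * n / a) ↔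
      l' = l + q ∧ t + u = t' + n * M := by
  have humklapp : latticePoint L r s o l' t' + Pi.single (-s) (2 * Real.pi * n / a) =
      latticePoint L r s o l' (t' + n * M) := by
    have hshift : 2 * Real.pi * n / a = 2 * Real.pi / L * (n * M) := by
      linear_combination 2 * (n : ℝ) * pi_div_eq hM
    rw [hshift, momentum_ext_iff s, Pi.add_apply, Pi.add_apply, Pi.single_eq_same,
      Pi.single_eq_of_ne (units_neg_ne s).symm, add_zero, latticePoint_self, latticePoint_self,
      latticePoint_neg, latticePoint_neg]
    push_cast
    exact ⟨rfl, by ring⟩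
  rw [latticePoint_add, humklapp, latticePoint_inj hL.ne', eq_comm (a := l')]

end Nodal

/-! ### The nodal operators -/

namespace Nodal

open FermionFock UnboundedOp

section Ladder

variable {L a : ℝ}

/-- The one-particle energy `r kₛ`, which is negative in the Dirac sea. -/
def modeEnergy (q : Mode L a) : ℝ := sgn q.r * q.k.1 q.s

/-- The nodal fermion operators, normalised by `{c(q), c†(q')} = δ_{q,q'}`. -/
noncomputable def ladder (q : Mode L a) : Fock L a →L[ℂ] Fock L a :=
  diracAnn {q | 0 < modeEnergy q} q

theorem psi_eq_smul_ladder (r s α : ℤˣ) (k : fermiMomenta L a s) :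
    psi r s α k = ((L / (2 * Real.pi) : ℝ) : ℂ) • ladder ⟨r, s, α, k⟩ :=
  congrArg (_ • ·) (if_congr Iff.rfl rfl rfl)

theorem psiDag_eq_smul_star_ladder (r s α : ℤˣ) (k : fermiMomenta L a s) :
    psiDag r s α k = ((L / (2 * Real.pi) : ℝ) : ℂ) • star (ladder ⟨r, s, α, k⟩) := by
  rw [psiDag, ← ContinuousLinearMap.star_eq_adjoint, psi_eq_smul_ladder, star_smul]
  exact congrArg (· • _) (Complex.conj_ofReal _)

theorem fermionOrder_smul (z : ℂ) (O : Fock L a →L[ℂ] Fock L a) :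
    fermionOrder (z • O) = z • fermionOrder O := by
  rw [fermionOrder, fermionOrder, smul_apply, inner_smul_right, smul_sub, smul_smul]

theorem star_fermionOrder (O : Fock L a →L[ℂ] Fock L a) :
    star (fermionOrder O) = fermionOrder (star O) := by
  rw [fermionOrder, fermionOrder, star_sub, star_smul, ContinuousLinearMap.star_eq_adjoint O,
    ContinuousLinearMap.adjoint_inner_right, ← inner_conj_symm (O _)]
  exact congrArg (fun A => _ - _ • A) (star_one (Fock L a →L[ℂ] Fock L a))

open Classical in
theorem fermionOrder_star_ladder_mul (q q' : Mode L a) :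
    fermionOrder (star (ladder q) * ladder q') =
      star (ladder q) * ladder q' -
        (if q = q' ∧ ¬ 0 < modeEnergy q then (1 : ℂ) else 0) • 1 :=
  congrArg (fun z : ℂ => _ - z • 1) (inner_vacuum_diracAnn _ q q')

theorem smul_fermionOrder_psi (hL : L ≠ 0) (r s α β : ℤˣ) (k k' : fermiMomenta L a s) (z : ℂ) :
    (((2 * Real.pi / L) ^ 2 : ℝ) : ℂ) •
        fermionOrder (psiDag r s α k * (z • psi r s β k')) =
      z • fermionOrder (star (ladder ⟨r, s, α, k⟩) * ladder ⟨r, s, β, k'⟩) := by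
  have hunit : (2 * Real.pi / L) ^ 2 * ((L / (2 * Real.pi)) * (L / (2 * Real.pi))) = 1 := by
    field_simp
  rw [psi_eq_smul_ladder, psiDag_eq_smul_star_ladder, mul_smul_comm, smul_mul_smul_comm,
    smul_smul, fermionOrder_smul, smul_smul, mul_left_comm, ← Complex.ofReal_mul,
    ← Complex.ofReal_mul, hunit, Complex.ofReal_one, mul_one]

end Ladder

section Symmetry

variable {L a : ℝ}

theorem star_pauli (μ : Fin 4) (α β : ℤˣ) : star (pauli μ α β) = pauli μ β α := by
  rcases Int.units_eq_one_or α with rfl | rfl <;> rcases Int.units_eq_one_or β with rfl | rfl <;>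
    fin_cases μ <;> simp [pauli, sgn, units_ne_neg_self]

theorem isFormalAdjoint_J (r s : ℤˣ) (μ : Fin 4) (p : Momentum) :
    (J L a r s μ p).IsFormalAdjoint (J L a r s μ (-p)) := by
  let swap : (ℤˣ × ℤˣ) × (fermiMomenta L a s × fermiMomenta L a s) × ℤ ≃
      (ℤˣ × ℤˣ) × (fermiMomenta L a s × fermiMomenta L a s) × ℤ :=
    (Equiv.prodComm _ _).prodCongr ((Equiv.prodComm _ _).prodCongr (Equiv.neg ℤ))
  have hrule (k k' : Momentum) (n : ℤ) :
      k + -p = k' + Pi.single (-s) (2 * Real.pi * n / a) ↔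
        k' + p = k + Pi.single (-s) (2 * Real.pi * (-n : ℤ) / a) := by
    rw [Int.cast_neg, mul_neg, neg_div, Pi.single_neg]
    constructor <;> intro h <;> linear_combination (exp := 1) -h
  have hstar (α β : ℤˣ) (k k' : fermiMomenta L a s) :
      star (psiDag r s α k * (pauli μ α β • psi r s β k')) =
        psiDag r s β k' * (pauli μ β α • psi r s α k) := by
    rw [psiDag, psiDag, ← ContinuousLinearMap.star_eq_adjoint,
      ← ContinuousLinearMap.star_eq_adjoint, star_mul, star_star, star_smul, star_pauli,
      smul_mul_assoc, mul_smul_comm]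
  rw [J, J, ← sum_comp_equiv swap]
  refine isFormalAdjoint_sum fun i => ?_
  obtain ⟨⟨α, β⟩, ⟨k, k'⟩, n⟩ := i
  simp only [swap, Equiv.prodCongr_apply, Prod.map_apply, Equiv.prodComm_apply, Prod.swap_prod_mk,
    Equiv.neg_apply, hrule]
  convert isFormalAdjoint_ofBounded (F := Fock L a) _ using 2
  split_ifs
  · rw [star_smul, star_fermionOrder, hstar]
    exact congrArg (· • _) (Complex.conj_ofReal _).symm
  · rw [star_zero]

theorem isFormalAdjoint_spinDensity (r s α : ℤˣ) (p : Momentum) :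
    (spinDensity L a r s α p).IsFormalAdjoint (spinDensity L a r s α (-p)) := by
  simpa [spinDensity] using isFormalAdjoint_smul (isFormalAdjoint_add (isFormalAdjoint_J r s 0 p)
    (isFormalAdjoint_smul (isFormalAdjoint_J r s 3 p) (sgn α))) (1 / 2)

theorem isFormalAdjoint_spinOp (r s : ℤˣ) (i : Fin 3) (p : Momentum) :
    (spinOp L a r s i p).IsFormalAdjoint (spinOp L a r s i (-p)) := by
  simpa [spinOp] using isFormalAdjoint_smul (isFormalAdjoint_J r s i.succ p) (1 / 2)

theorem isFormalAdjoint_orderedSquare {A : Momentum → (Fock L a →ₗ.[ℂ] Fock L a)}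
    (hA : ∀ p, (A p).IsFormalAdjoint (A (-p))) (r s : ℤˣ) (p : Momentum) :
    (orderedSquare r s A p).IsFormalAdjoint (orderedSquare r s A p) := by
  have hA' : (A (-p)).IsFormalAdjoint (A p) := (hA p).symm
  rw [orderedSquare, bosonOrder]
  split_ifs
  · exact isFormalAdjoint_mul hA' (hA p)
  · exact isFormalAdjoint_mul (hA p) hA'

theorem isFormalAdjoint_kronigForm (r s : ℤˣ) :
    (kronigForm L a r s).IsFormalAdjoint (kronigForm L a r s) := by
  rw [kronigForm]
  have hsquare (i : ℤˣ × bosonMomenta L a s) :=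
    isFormalAdjoint_orderedSquare (isFormalAdjoint_spinDensity (L := L) (a := a) r s i.1) r s i.2.1
  exact isFormalAdjoint_smul
    (isFormalAdjoint_sum fun i => isFormalAdjoint_smul (hsquare i) (1 / L ^ 2)) (a * Real.pi)

theorem isFormalAdjoint_sugawaraForm (r s : ℤˣ) :
    (sugawaraForm L a r s).IsFormalAdjoint (sugawaraForm L a r s) := by
  rw [sugawaraForm]
  refine isFormalAdjoint_smul (isFormalAdjoint_sum fun p => isFormalAdjoint_smul ?_ (1 / L ^ 2))
    (a * Real.pi)
  simpa using isFormalAdjoint_add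
    (isFormalAdjoint_smul (isFormalAdjoint_orderedSquare (isFormalAdjoint_J r s 0) r s p.1) (1 / 2))
    (isFormalAdjoint_smul (isFormalAdjoint_finsetSum Finset.univ fun i _ =>
      isFormalAdjoint_orderedSquare (isFormalAdjoint_spinOp r s i) r s p.1) (2 / 3))

end Symmetry

section Kinetic

variable {L a : ℝ}

theorem smul_fermionOrder_number_basisVec (q : Mode L a) (S : Finset (Mode L a)) :
    ((modeEnergy q : ℂ) • fermionOrder (star (ladder q) * ladder q)) (basisVec S) =
      ((if q ∈ S then |modeEnergy q| else 0 : ℝ) : ℂ) • basisVec S := by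
  have hnumber : fermionOrder (star (ladder q) * ladder q) =
      (if 0 < modeEnergy q then (1 : ℂ) else -1) • (star (ann q) * ann q) := by
    rw [fermionOrder_star_ladder_mul]
    refine Eq.trans ?_ (star_diracAnn_mul_self {q | 0 < modeEnergy q} q)
    simp only [true_and, ite_not, Set.mem_ofPred_eq]
    rfl
  rw [hnumber, smul_smul, smul_apply, number_basisVec, smul_smul]
  congr 1
  split_ifs with henergy
  · rw [abs_of_pos henergy, mul_one, mul_one]
  · rw [mul_zero, Complex.ofReal_zero]
  · rw [abs_of_nonpos (not_lt.1 henergy), mul_one, mul_neg, mul_one, Complex.ofReal_neg]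
  · rw [mul_zero, Complex.ofReal_zero]

/-- The kinetic energy of flavor `(r, s)` in the occupation number state `S`. -/
noncomputable def excitationEnergy (r s : ℤˣ) (S : Finset (Mode L a)) : ℝ :=
  ∑' i : ℤˣ × fermiMomenta L a s,
    if (⟨r, s, i.1, i.2⟩ : Mode L a) ∈ S then |modeEnergy ⟨r, s, i.1, i.2⟩| else 0

theorem hasSum_excitationEnergy (r s : ℤˣ) (S : Finset (Mode L a)) :
    HasSum (fun i : ℤˣ × fermiMomenta L a s =>
      if (⟨r, s, i.1, i.2⟩ : Mode L a) ∈ S then |modeEnergy ⟨r, s, i.1, i.2⟩| else 0)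
      (excitationEnergy r s S) := by
  have hinj : Function.Injective fun i : ℤˣ × fermiMomenta L a s =>
      (⟨r, s, i.1, i.2⟩ : Mode L a) := fun i j h => by
    simpa [Prod.ext_iff] using h
  exact (summable_of_hasFiniteSupport ((S.finite_toSet.preimage hinj.injOn).subset fun i hi => by
    by_contra h
    exact hi (if_neg h))).hasSum

theorem isDiagonal_kineticEnergy (hL : L ≠ 0) (r s : ℤˣ) :
    IsDiagonal (numberBasis (Mode L a)) (excitationEnergy r s) (kineticEnergy L a r s) := by
  refine isDiagonal_sum (fun i S => ?_) (hasSum_excitationEnergy r s) fun i S => ?_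
  · split_ifs
    · exact abs_nonneg _
    · exact le_rfl
  · have hterm := smul_fermionOrder_psi hL r s i.1 i.1 i.2 i.2 1
    rw [one_smul, one_smul] at hterm
    rw [Complex.ofReal_mul, mul_comm, mul_smul, hterm, numberBasis_apply]
    exact smul_fermionOrder_number_basisVec ⟨r, s, i.1, i.2⟩ S

end Kinetic

end Nodal

/-! ### Nodal densities on confined states -/

namespace Nodal

open FermionFock UnboundedOp Site

variable {L a : ℝ} {M : ℕ} [NeZero M] (hL : 0 < L) (hM : L = M * a) (r s : ℤˣ)

/-- The mode of flavor `(r, s)` with the given spin and integer coordinates. -/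
noncomputable def mode (x : Site ℤˣ (ZMod M)) : Mode L a := ⟨r, s, x.1, fermiChart hL hM r s x.2⟩

theorem mode_injective : Function.Injective (mode hL hM r s) := fun x y h => by
  simpa [mode, Prod.ext_iff] using h

theorem modeEnergy_mode (x : Site ℤˣ (ZMod M)) :
    modeEnergy (mode hL hM r s x) = 2 * Real.pi / L * (x.2.1 + 1 / 2) := by
  rw [modeEnergy, mode, coe_fermiChart, latticePoint_self, ← mul_assoc, sgn_mul_self, one_mul]

theorem modeEnergy_mode_pos (x : Site ℤˣ (ZMod M)) :
    0 < modeEnergy (mode hL hM r s x) ↔ 0 ≤ x.2.1 := by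
  have hunit : 0 < 2 * Real.pi / L := by positivity
  rw [modeEnergy_mode, mul_pos_iff_of_pos_left hunit]
  constructor <;> intro h
  · have : (-1 : ℝ) < x.2.1 := by linarith
    have : -1 < x.2.1 := by exact_mod_cast this
    lia
  · have : (0 : ℝ) ≤ x.2.1 := by exact_mod_cast h
    linarith

/-- The normalised fermion operators of flavor `(r, s)` in integer coordinates. -/
noncomputable def siteLadder (x : Site ℤˣ (ZMod M)) : Fock L a →L[ℂ] Fock L a :=
  ladder (mode hL hM r s x)

theorem isCAR_siteLadder :
    IsCAR (siteLadder hL hM r s) fun x => star (siteLadder hL hM r s x) :=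
  (isCAR_diracAnn _).comp_injective (mode_injective hL hM r s)

theorem fermionOrder_siteLadder (x y : Site ℤˣ (ZMod M)) :
    fermionOrder (star (siteLadder hL hM r s x) * siteLadder hL hM r s y) =
      normalBilin (siteLadder hL hM r s) (fun x => star (siteLadder hL hM r s x)) x y := by
  rw [siteLadder, siteLadder, fermionOrder_star_ladder_mul]
  simp only [(mode_injective hL hM r s).eq_iff, modeEnergy_mode_pos, not_le, ite_and]
  rfl

/-- The states of flavor `(r, s)` which look like the Dirac vacuum outside the window `[-N, N)`. -/
noncomputable def confinedStates (N : ℕ) : Submodule ℂ (Fock L a) :=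
  confined (siteLadder hL hM r s) (fun x => star (siteLadder hL hM r s x)) N

theorem exists_basisVec_mem_confinedStates (S : Finset (Mode L a)) :
    ∃ N, basisVec S ∈ confinedStates hL hM r s N := by
  have hfin : (mode hL hM r s ⁻¹' S).Finite :=
    S.finite_toSet.preimage (mode_injective hL hM r s).injOn
  obtain ⟨N, hN⟩ := (hfin.image fun x => x.2.1.natAbs).bddAbove
  have hempty (x : Site ℤˣ (ZMod M)) (hx : N < x.2.1.natAbs) : mode hL hM r s x ∉ S := fun h =>
    hx.not_ge (hN ⟨x, h, rfl⟩)
  refine ⟨N + 1, fun x => ⟨fun hx => ?_, fun hx => ?_⟩⟩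
  · have hpos : 0 < modeEnergy (mode hL hM r s x) := (modeEnergy_mode_pos hL hM r s x).2 (by lia)
    have hann : siteLadder hL hM r s x = ann (mode hL hM r s x) := if_pos hpos
    rw [hann, ann_basisVec, if_neg (hempty x (by lia))]
  · have hneg : ¬ 0 < modeEnergy (mode hL hM r s x) :=
      mt (modeEnergy_mode_pos hL hM r s x).1 (by lia)
    have hcre : star (siteLadder hL hM r s x) = ann (mode hL hM r s x) :=
      (congrArg star (if_neg hneg)).trans (star_star _)
    beta_reduce
    rw [hcre, ann_basisVec, if_neg (hempty x (by lia))]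

theorem exists_mem_confinedStates {η : Fock L a} (hη : η ∈ finiteVectors (Mode L a)) :
    ∃ N, η ∈ confinedStates hL hM r s N := by
  induction hη using Submodule.span_induction with
  | mem η hη =>
    obtain ⟨S, rfl⟩ := hη
    exact exists_basisVec_mem_confinedStates hL hM r s S
  | zero => exact ⟨0, zero_mem _⟩
  | add η ξ _ _ hη hξ =>
    obtain ⟨N, hN⟩ := hη
    obtain ⟨N', hN'⟩ := hξ
    exact ⟨max N N', add_mem (confined_mono (le_max_left _ _) hN)
      (confined_mono (le_max_right _ _) hN')⟩
  | smul z η _ hη =>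
    obtain ⟨N, hN⟩ := hη
    exact ⟨N, Submodule.smul_mem _ z hN⟩

/-- The nodal density with spin matrix `U` and momentum `p`, cut off to the window `[-N, N)`. -/
noncomputable def cutoffDensity (N : ℕ) (p : ℤ × ZMod M) :
    Matrix ℤˣ ℤˣ ℂ →ₗ[ℂ] (Fock L a →L[ℂ] Fock L a) :=
  normalQuad N (siteLadder hL hM r s) (fun x => star (siteLadder hL hM r s x)) ∘ₗ hop p

variable {hL hM r s} {N N' : ℕ} {η : Fock L a}

theorem cutoffDensity_mem_confinedStates (hη : η ∈ confinedStates hL hM r s N) (p : ℤ × ZMod M)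
    (U : Matrix ℤˣ ℤˣ ℂ) : cutoffDensity hL hM r s N p U η ∈ confinedStates hL hM r s N :=
  normalQuad_mem_confined (isCAR_siteLadder hL hM r s) hη _

theorem cutoffDensity_eq_zero (hη : η ∈ confinedStates hL hM r s N) (U : Matrix ℤˣ ℤˣ ℂ)
    {p : ℤ × ZMod M} (hp : 2 * (N : ℤ) ≤ p.1) : cutoffDensity hL hM r s N' p U η = 0 :=
  normalQuad_hop_eq_zero (isCAR_siteLadder hL hM r s) hη U hp

theorem mem_graph_J (hη : η ∈ confinedStates hL hM r s N) (μ : Fin 4) {q : ℤ} (t : ℤ)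
    (hN : N + |q| ≤ (N' : ℤ)) :
    (η, cutoffDensity hL hM r s N' (q, t) (pauli μ) η) ∈
      (J L a r s μ (latticePoint L r s 0 q t)).graph := by
  let coords : (Site ℤˣ (ZMod M) × Site ℤˣ (ZMod M)) × ℤ ≃
      (ℤˣ × ℤˣ) × (fermiMomenta L a s × fermiMomenta L a s) × ℤ :=
    (((Equiv.prodProdProdComm _ _ _ _).prodCongr (Equiv.refl ℤ)).trans
      (Equiv.prodAssoc _ _ _)).trans ((Equiv.refl _).prodCongr
        (((fermiChart hL hM r s).prodCongr (fermiChart hL hM r s)).prodCongr (Equiv.refl ℤ)))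
  have hsum := hasSum_ite_eq_snd
    (hasSum_normalBilin_hop (isCAR_siteLadder hL hM r s) hη (pauli μ) (p := (q, (t : ZMod M))) hN)
    fun i => (transverse (1 / 2) i.1.2.2 + t - transverse (1 / 2) i.2.2.2) / M
  rw [J, ← sum_comp_equiv coords]
  refine mem_graph_sum.2 ⟨_, fun i => ?_, hsum⟩
  obtain ⟨⟨x, y⟩, n⟩ := i
  have hrule : (fermiChart hL hM r s x.2).1 + latticePoint L r s 0 q t =
        (fermiChart hL hM r s y.2).1 + Pi.single (-s) (2 * Real.pi * n / a) ↔
      n = (transverse (1 / 2) x.2.2 + t - transverse (1 / 2) y.2.2) / M ∧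
        y.2 = x.2 + (q, (t : ZMod M)) := by
    rw [coe_fermiChart, coe_fermiChart, latticePoint_add_eq_iff hL hM,
      rep_add_eq_iff (cast_transverse _), Prod.ext_iff, and_comm (a := n = _), and_assoc]
    rfl
  refine mem_graph_ofBounded.2 ?_
  change (if (fermiChart hL hM r s x.2).1 + latticePoint L r s 0 q t =
    (fermiChart hL hM r s y.2).1 + Pi.single (-s) (2 * Real.pi * n / a) then _ else _ :
      Fock L a →L[ℂ] Fock L a) η = _
  simp only [hrule, hop_apply, ite_smul, zero_smul, ← ite_and]
  split_ifs
  · rw [smul_fermionOrder_psi hL.ne', ← fermionOrder_siteLadder, smul_apply]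
    rfl
  · rfl

end Nodal

/-! ### The Kronig identity and the Sugawara construction on confined states -/

namespace Nodal

open FermionFock UnboundedOp Site

section IsDensity

variable {L a : ℝ} {M : ℕ} [NeZero M] {hL : 0 < L} {hM : L = M * a} {r s : ℤˣ} {N N' : ℕ}
  {η : Fock L a} {A B : Momentum → (Fock L a →ₗ.[ℂ] Fock L a)} {U V : Matrix ℤˣ ℤˣ ℂ}

/-- `A` is the family of nodal densities of flavor `(r, s)` with spin matrix `U`: on confined states
`A(p)` acts as the density cut off to a window which leaves room for the momentum transfer. -/
def IsDensity (hL : 0 < L) (hM : L = M * a) (r s : ℤˣ)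
    (A : Momentum → (Fock L a →ₗ.[ℂ] Fock L a)) (U : Matrix ℤˣ ℤˣ ℂ) : Prop :=
  ∀ ⦃N N' : ℕ⦄ ⦃q : ℤ⦄ (t : ℤ) ⦃η : Fock L a⦄, η ∈ confinedStates hL hM r s N →
    N + |q| ≤ (N' : ℤ) → (η, cutoffDensity hL hM r s N' (q, t) U η) ∈
      (A (latticePoint L r s 0 q t)).graph

theorem isDensity_J (μ : Fin 4) : IsDensity hL hM r s (J L a r s μ) (pauli μ) :=
  fun _ _ _ t _ hη hN => mem_graph_J hη μ t hN

theorem IsDensity.add (hA : IsDensity hL hM r s A U) (hB : IsDensity hL hM r s B V) :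
    IsDensity hL hM r s (fun p => A p + B p) (U + V) := fun _ _ _ t _ hη hN =>
  mem_graph_add.2 ⟨_, _, hA t hη hN, hB t hη hN, by rw [map_add, add_apply]⟩

theorem IsDensity.smul (hA : IsDensity hL hM r s A U) (z : ℂ) :
    IsDensity hL hM r s (fun p => z • A p) (z • U) := fun _ _ _ t _ hη hN =>
  mem_graph_smul.2 ⟨_, hA t hη hN, by rw [map_smul, smul_apply]⟩

/-- The factors `5` and `3` leave room for the momentum transfer of a density of momentum at most
`2N`, beyond which it annihilates the confined states. -/
theorem IsDensity.mem_graph_mul (hA : IsDensity hL hM r s A U)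
    (hη : η ∈ confinedStates hL hM r s N) {q : ℤ} (hq : 0 ≤ q) (t : ℤ) (hN : 5 * N ≤ N') :
    (η, cutoffDensity hL hM r s N' (-q, ((-t : ℤ) : ZMod M)) U
        (cutoffDensity hL hM r s N' (q, t) U η)) ∈
      (mul (A (latticePoint L r s 0 (-q) (-t))) (A (latticePoint L r s 0 q t))).graph := by
  have habs : |q| = q := abs_of_nonneg hq
  obtain hlarge | hsmall := le_or_gt (2 * (N : ℤ)) q
  · have hzero (K : ℕ) : cutoffDensity hL hM r s K (q, t) U η = 0 :=
      cutoffDensity_eq_zero hη U hlarge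
    have hmem := hA (N' := N + q.natAbs) t hη (by rw [habs]; lia)
    rw [hzero] at hmem
    rw [hzero, map_zero]
    exact UnboundedOp.mem_graph_mul.2 ⟨0, hmem, Submodule.zero_mem _⟩
  · have hξ : cutoffDensity hL hM r s (3 * N) (q, t) U η ∈ confinedStates hL hM r s (3 * N) :=
      cutoffDensity_mem_confinedStates (confined_mono (by lia) hη) _ U
    have hmem := hA (N' := 3 * N) t hη (by rw [habs]; lia)
    have hvalue : cutoffDensity hL hM r s N' (q, t) U η =
        cutoffDensity hL hM r s (3 * N) (q, t) U η :=
      LinearPMap.mem_graph_snd_inj _ (hA t hη (by rw [habs]; lia)) hmem rfl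
    rw [hvalue]
    exact UnboundedOp.mem_graph_mul.2 ⟨_, hmem, hA (-t) hξ (by rw [abs_neg, habs]; lia)⟩

theorem IsDensity.mem_graph_orderedSquare (hA : IsDensity hL hM r s A U)
    (hη : η ∈ confinedStates hL hM r s N) (p : ℤ × ZMod M) (hN : 5 * N ≤ N') :
    (η, cutoffDensity hL hM r s N' (-forward p) U
        (cutoffDensity hL hM r s N' (forward p) U η)) ∈
      (orderedSquare r s A (bosonChart hL hM r s p).1).graph := by
  obtain ⟨q, z⟩ := p
  rw [coe_bosonChart, orderedSquare, bosonOrder, neg_latticePoint, forward]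
  simp only [sgn_mul_latticePoint_neg_iff hL, neg_lt_zero]
  have hcast : ((transverse 0 z : ℤ) : ZMod M) = z := cast_transverse 0 z
  split_ifs with hq
  · have hmul := hA.mem_graph_mul hη hq.le (transverse 0 z) hN
    rwa [Int.cast_neg, hcast] at hmul
  · have hmul := hA.mem_graph_mul hη (neg_nonneg.2 (not_lt.1 hq)) (-transverse 0 z) hN
    rw [neg_neg (q, z)]
    rwa [neg_neg, neg_neg, Int.cast_neg, hcast] at hmul

/-- The value of the kinetic energy on a state confined to `[-N, N)`, in units of `2π/L`. The window
is five times larger than necessary, to match the cutoff of the squares of densities. -/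
noncomputable def windowEnergy (hL : 0 < L) (hM : L = M * a) (r s : ℤˣ) (N : ℕ)
    (η : Fock L a) : Fock L a :=
  ∑ x ∈ window ℤˣ (ZMod M) (5 * N), ((x.2.1 : ℂ) + 1 / 2) •
    normalBilin (siteLadder hL hM r s) (fun x => star (siteLadder hL hM r s x)) x x η

theorem mem_graph_kineticEnergy (hη : η ∈ confinedStates hL hM r s N) :
    (η, ((2 * Real.pi / L : ℝ) : ℂ) • windowEnergy hL hM r s N η) ∈
      (kineticEnergy L a r s).graph := by
  rw [kineticEnergy, ← sum_comp_equiv ((Equiv.refl ℤˣ).prodCongr (fermiChart hL hM r s))]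
  have hsum := (hasSum_normalBilin_self (isCAR_siteLadder hL hM r s) hη
    (show N ≤ 5 * N by lia) fun x => (x.2.1 : ℂ) + 1 / 2).const_smul ((2 * Real.pi / L : ℝ) : ℂ)
  refine mem_graph_sum.2 ⟨_, fun x => mem_graph_ofBounded.2 ?_, hsum⟩
  have hterm := smul_fermionOrder_psi hL.ne' r s x.1 x.1 (fermiChart hL hM r s x.2)
    (fermiChart hL hM r s x.2) 1
  rw [one_smul, one_smul] at hterm
  have henergy : sgn r * (fermiChart hL hM r s x.2).1 s = 2 * Real.pi / L * (x.2.1 + 1 / 2) :=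
    modeEnergy_mode hL hM r s x
  rw [← fermionOrder_siteLadder]
  simp only [Equiv.prodCongr_apply, Prod.map_fst, Prod.map_snd, Equiv.refl_apply]
  rw [henergy, Complex.ofReal_mul, mul_comm, mul_smul, hterm, Complex.ofReal_mul, mul_smul,
    smul_apply, smul_apply]
  push_cast
  rfl

variable {κ : Type*} [Fintype κ] {w : κ → ℂ} {W : κ → Matrix ℤˣ ℤˣ ℂ}

theorem hasSum_cutoffDensity_sq (hη : η ∈ confinedStates hL hM r s N)
    (hW : IsSpinResolution w W) :
    HasSum (fun i : κ × ℤ × ZMod M => w i.1 •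
        cutoffDensity hL hM r s (5 * N) (-forward i.2) (W i.1)
          (cutoffDensity hL hM r s (5 * N) (forward i.2) (W i.1) η))
      ((2 * M : ℂ) • windowEnergy hL hM r s N η) := by
  have hkronig := DFunLike.congr_fun (sum_normalQuad_hop (isCAR_siteLadder hL hM r s) hW
    (N := 5 * N) (Q := 10 * N + 1) (by lia) (by lia)) η
  simp only [sum_apply, smul_apply, mul_apply_eq_comp, ZMod.card, Finset.smul_sum (N := Fock L a),
    ← Finset.sum_product'] at hkronig
  rw [windowEnergy, Finset.smul_sum, ← hkronig]
  refine hasSum_sum_of_ne_finset_zero fun i hi => ?_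
  have hlarge : 2 * (N : ℤ) ≤ (forward i.2).1 := by
    rw [fst_forward]
    by_contra! hsmall
    rw [abs_lt] at hsmall
    refine hi (Finset.mem_product.2 ⟨Finset.mem_univ _, Finset.mem_product.2
      ⟨Finset.mem_Ioo.2 ?_, Finset.mem_univ _⟩⟩)
    lia
  rw [cutoffDensity_eq_zero hη _ hlarge, map_zero, smul_zero]

end IsDensity

theorem boson_coeff_smul {F : Type*} [AddCommGroup F] [Module ℂ F] {L a : ℝ} {M : ℕ} (hL : 0 < L)
    (hM : L = M * a) (ζ : F) :
    ((a * Real.pi : ℝ) : ℂ) • ((1 / L ^ 2 : ℝ) : ℂ) • (2 * M : ℂ) • ζ =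
      ((2 * Real.pi / L : ℝ) : ℂ) • ζ := by
  have hcoeff : a * Real.pi * (1 / L ^ 2) * (2 * M) = 2 * Real.pi / L := by
    have hL' := hL.ne'
    field_simp
    rw [hM]
    ring
  rw [smul_smul, smul_smul, ← hcoeff]
  push_cast
  rfl

section SpinResolution

/-- The spin matrices of the densities `J_α`. -/
noncomputable def spinProjection (γ : ℤˣ) : Matrix ℤˣ ℤˣ ℂ :=
  (1 / 2 : ℂ) • (pauli 0 + (sgn γ : ℂ) • pauli 3)

/-- The spin matrices of `J` and of the three spin operators. -/
noncomputable def sugawaraMatrix : Option (Fin 3) → Matrix ℤˣ ℤˣ ℂ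
  | none => pauli 0
  | some i => (1 / 2 : ℂ) • pauli i.succ

/-- The weights of `J` and of the three spin operators in the Sugawara form. -/
noncomputable def sugawaraWeight : Option (Fin 3) → ℂ
  | none => 1 / 2
  | some _ => 2 / 3

theorem spinProjection_eq_single (γ : ℤˣ) : spinProjection γ = Matrix.single γ γ 1 := by
  ext α β
  rcases Int.units_eq_one_or α with rfl | rfl <;> rcases Int.units_eq_one_or β with rfl | rfl <;>
    rcases Int.units_eq_one_or γ with rfl | rfl <;>
    norm_num [spinProjection, pauli, sgn, Matrix.single, units_neg_ne]

theorem isSpinResolution_spinProjection : IsSpinResolution (fun _ => 1) spinProjection where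
  symm α δ β γ := by
    simp only [spinProjection_eq_single, Matrix.single, Matrix.of_apply, one_mul]
    grind
  one := by
    simp only [spinProjection_eq_single, one_smul, Matrix.single_mul_single_same, mul_one]
    exact Matrix.sum_single_one

theorem pauli_succ_mul_self (i : Fin 3) : pauli i.succ * pauli i.succ = 1 := by
  fin_cases i <;> ext α β <;> rcases Int.units_eq_one_or α with rfl | rfl <;>
    rcases Int.units_eq_one_or β with rfl | rfl <;>
    simp [pauli, sgn, units_ne_neg_self, Matrix.mul_apply]

/-- The completeness relation of the Pauli matrices. -/
theorem sum_pauli_succ_mul (α β γ δ : ℤˣ) :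
    ∑ i : Fin 3, pauli i.succ α δ * pauli i.succ β γ =
      2 * (if α = γ ∧ β = δ then 1 else 0) - if α = δ ∧ β = γ then 1 else 0 := by
  have hsum : ∑ i : Fin 3, pauli i.succ α δ * pauli i.succ β γ =
      pauli 1 α δ * pauli 1 β γ + pauli 2 α δ * pauli 2 β γ + pauli 3 α δ * pauli 3 β γ :=
    Fin.sum_univ_three _
  rw [hsum]
  rcases Int.units_eq_one_or α with rfl | rfl <;> rcases Int.units_eq_one_or β with rfl | rfl <;>
    rcases Int.units_eq_one_or γ with rfl | rfl <;> rcases Int.units_eq_one_or δ with rfl | rfl <;>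
    norm_num [pauli, sgn, units_neg_ne, units_ne_neg_self]

theorem isSpinResolution_sugawaraMatrix : IsSpinResolution sugawaraWeight sugawaraMatrix where
  symm α δ β γ := by
    have hcomplete (γ δ : ℤˣ) : ∑ i, sugawaraWeight i * (sugawaraMatrix i α δ *
        sugawaraMatrix i β γ) =
          1 / 2 * (pauli 0 α δ * pauli 0 β γ) + 1 / 6 * (2 * (if α = γ ∧ β = δ then 1 else 0) -
            if α = δ ∧ β = γ then 1 else 0) := by
      rw [← sum_pauli_succ_mul, Fintype.sum_option, Finset.mul_sum]
      congr 1
      refine Finset.sum_congr rfl fun i _ => ?_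
      simp only [sugawaraWeight, sugawaraMatrix, Matrix.smul_apply, smul_eq_mul]
      ring
    rw [hcomplete, hcomplete]
    simp only [pauli, Matrix.one_apply, ite_and]
    grind
  one := by
    simp only [Fintype.sum_option, sugawaraWeight, sugawaraMatrix, smul_mul_smul_comm,
      pauli_succ_mul_self, Finset.sum_const, Finset.card_univ, Fintype.card_fin]
    rw [show pauli 0 = 1 from rfl, mul_one]
    module

end SpinResolution

section Forms

variable {L a : ℝ} {M : ℕ} [NeZero M] {hL : 0 < L} {hM : L = M * a} {r s : ℤˣ} {N : ℕ}
  {η : Fock L a}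

theorem isDensity_spinDensity (α : ℤˣ) :
    IsDensity hL hM r s (spinDensity L a r s α) (spinProjection α) :=
  ((isDensity_J 0).add ((isDensity_J 3).smul _)).smul _

theorem isDensity_spinOp (i : Fin 3) :
    IsDensity hL hM r s (spinOp L a r s i) (sugawaraMatrix (some i)) :=
  (isDensity_J i.succ).smul _

theorem mem_graph_kronigForm (hη : η ∈ confinedStates hL hM r s N) :
    (η, ((2 * Real.pi / L : ℝ) : ℂ) • windowEnergy hL hM r s N η) ∈
      (kronigForm L a r s).graph := by
  have hsum := hasSum_cutoffDensity_sq hη isSpinResolution_spinProjection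
  simp only [one_smul] at hsum
  rw [kronigForm, ← sum_comp_equiv ((Equiv.refl ℤˣ).prodCongr (bosonChart hL hM r s)),
    ← boson_coeff_smul hL hM]
  refine mem_graph_smul.2 ⟨_, mem_graph_sum.2 ⟨_, fun i => mem_graph_smul.2 ⟨_, ?_, rfl⟩,
    hsum.const_smul _⟩, rfl⟩
  exact (isDensity_spinDensity i.1).mem_graph_orderedSquare hη i.2 le_rfl

theorem mem_graph_sugawaraForm (hη : η ∈ confinedStates hL hM r s N) :
    (η, ((2 * Real.pi / L : ℝ) : ℂ) • windowEnergy hL hM r s N η) ∈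
      (sugawaraForm L a r s).graph := by
  have hsum := ((Equiv.prodComm _ _).hasSum_iff.2
    (hasSum_cutoffDensity_sq hη isSpinResolution_sugawaraMatrix)).prod_fiberwise
      fun p => hasSum_fintype _
  rw [sugawaraForm, ← sum_comp_equiv (bosonChart hL hM r s), ← boson_coeff_smul hL hM]
  refine mem_graph_smul.2 ⟨_, mem_graph_sum.2 ⟨_, fun p => mem_graph_smul.2 ⟨_, ?_, rfl⟩,
    hsum.const_smul _⟩, rfl⟩
  refine mem_graph_add.2 ⟨_, _,
    mem_graph_smul.2 ⟨_, (isDensity_J 0).mem_graph_orderedSquare hη p le_rfl, rfl⟩,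
    mem_graph_smul.2 ⟨_, mem_graph_finsetSum _ fun i _ =>
      (isDensity_spinOp i).mem_graph_orderedSquare hη p le_rfl, rfl⟩, ?_⟩
  rw [Fintype.sum_option, Finset.smul_sum]
  rfl

theorem exists_common_value (hL : 0 < L) (hLa : ∃ M : ℕ, L = M * a) (r s : ℤˣ)
    (hη : η ∈ finiteVectors (Mode L a)) :
    ∃ ξ, (η, ξ) ∈ (kineticEnergy L a r s).graph ∧ (η, ξ) ∈ (kronigForm L a r s).graph ∧
      (η, ξ) ∈ (sugawaraForm L a r s).graph := by
  obtain ⟨M, hM⟩ := hLa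
  have : NeZero M := ⟨by rintro rfl; simp [hL.ne'] at hM⟩
  obtain ⟨N, hN⟩ := exists_mem_confinedStates hL hM r s hη
  exact ⟨_, mem_graph_kineticEnergy hN, mem_graph_kronigForm hN, mem_graph_sugawaraForm hN⟩

end Forms

section Closure

variable {L a : ℝ}

theorem closure_eq_kineticEnergy (hL : L ≠ 0) {r s : ℤˣ} {T : Fock L a →ₗ.[ℂ] Fock L a}
    (hsymm : T.IsFormalAdjoint T)
    (h : ∀ η ∈ finiteVectors (Mode L a), ∃ ξ, (η, ξ) ∈ (kineticEnergy L a r s).graph ∧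
      (η, ξ) ∈ T.graph) : T.closure = kineticEnergy L a r s := by
  refine (isDiagonal_kineticEnergy hL r s).closure_eq (fun S => ?_) hsymm
  have hbasis := (isDiagonal_kineticEnergy hL r s).basis_mem_graph S
  rw [numberBasis_apply] at hbasis ⊢
  obtain ⟨ξ, hkinetic, hT⟩ := h _ (Submodule.subset_span ⟨S, rfl⟩)
  rwa [← LinearPMap.mem_graph_snd_inj _ hkinetic hbasis rfl]

end Closure

end Nodal

theorem propositionC4 (L a : ℝ) (hL : 0 < L) (ha : 0 < a) (hLa : ∃ M : ℕ, L = M * a)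
    (r s : ℤˣ) :
    (∀ η ∈ FermionFock.finiteVectors (Nodal.Mode L a),
      ∃ (h₁ : η ∈ (Nodal.kineticEnergy L a r s).domain)
        (h₂ : η ∈ (Nodal.kronigForm L a r s).domain)
        (h₃ : η ∈ (Nodal.sugawaraForm L a r s).domain),
        Nodal.kineticEnergy L a r s ⟨η, h₁⟩ = Nodal.kronigForm L a r s ⟨η, h₂⟩ ∧
        Nodal.kronigForm L a r s ⟨η, h₂⟩ = Nodal.sugawaraForm L a r s ⟨η, h₃⟩) ∧
    Nodal.kineticEnergy L a r s = (Nodal.kronigForm L a r s).closure ∧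
    (Nodal.kronigForm L a r s).closure = (Nodal.sugawaraForm L a r s).closure ∧
    IsSelfAdjoint (Nodal.kineticEnergy L a r s) ∧
    IsSelfAdjoint (Nodal.kronigForm L a r s).closure ∧
    IsSelfAdjoint (Nodal.sugawaraForm L a r s).closure := by
  open Nodal UnboundedOp in
  have hvalue {η} := exists_common_value (η := η) hL hLa r s
  have hself : IsSelfAdjoint (kineticEnergy L a r s) :=
    (isDiagonal_kineticEnergy hL.ne' r s).isSelfAdjoint
  have hkronig : (kronigForm L a r s).closure = kineticEnergy L a r s :=
    closure_eq_kineticEnergy hL.ne' (isFormalAdjoint_kronigForm r s) fun η hη =>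
      (hvalue hη).imp fun _ h => ⟨h.1, h.2.1⟩
  have hsugawara : (sugawaraForm L a r s).closure = kineticEnergy L a r s :=
    closure_eq_kineticEnergy hL.ne' (isFormalAdjoint_sugawaraForm r s) fun η hη =>
      (hvalue hη).imp fun _ h => ⟨h.1, h.2.2⟩
  rw [hkronig, hsugawara]
  refine ⟨fun η hη => ?_, rfl, rfl, hself, hself, hself⟩
  obtain ⟨ξ, hkin, hkro, hsug⟩ := hvalue hη
  obtain ⟨h₁, heq₁⟩ := mem_graph_iff_exists.1 hkin
  obtain ⟨h₂, heq₂⟩ := mem_graph_iff_exists.1 hkro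
  obtain ⟨h₃, heq₃⟩ := mem_graph_iff_exists.1 hsug
  exact ⟨h₁, h₂, h₃, heq₁.trans heq₂.symm, heq₂.trans heq₃.symm⟩
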